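/- Representatives of elements of $l_0(\{e\})$ are triples $(V_0\xleftarrow{f}K\xrightarrow{g}V_1,\lambda,\mu)$, where $K$ is a finitely generated abelian group, $V_0,V_1$ are finitely generated free abelian groups, $f,g$ are homomorphisms, $\lambda:V_0\to V_1^*$ is an isomorphism such that $\lambda_K(x,y):=\lambda(f(x),g(y))$ is symmetric on $K$, and $\mu:K\to\mathbb Z$ is a quadratic refinement of $\lambda_K$ (so $\lambda_K(x,x)=2\mu(x)$; thus $\mu$ is determined by $\lambda_K$, and is omitted from the notation). Two triples represent the same element of $l_0(\{e\})$ if they become isometric after adding to each of them an orthogonal sum of hyperbolic planes. (As $\mathrm{Wh}(\{e\})=0$, preferred bases carry no information here.) An element of $l_0(\{e\})$ is *elementary* if it has a representative as above with a free subgroup $U\subset K$ such that (i) $\lambda_K$ and $\mu$ vanish on $U$; (ii) $f$ and $g$ are injective on $U$ and $U_0=f(U)$, $U_1=g(U)$ are direct summands of $V_0$, $V_1$; (iii) $\lambda$ induces an isomorphism $U_0\to(V_1/U_1)^*$. **Proposition 13.** Let $V$ be a finitely generated free abelian group, $V^*=\mathrm{Hom}(V,\mathbb Z)$, let $S:V\to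 V^*$ be the adjoint of a bilinear form on $V$, let $\rho:V\to A$ be a surjection onto a free abelian group, let $H$ be a finite abelian group, and let $$0\to V\xrightarrow{S}V^*\xrightarrow{j}H\oplus H\to0$$ be exact. Let $p_0,p_1:H\oplus H\to H$ be the two projections. Suppose: a) $S$ is symmetric and nondegenerate and $\mathrm{sign}\,S=0$. b) If $S(v_i)=\rho^*(\alpha_i)$ with $v_i\in V$, $\alpha_i\in A^*$ $(i=1,2)$, then $S(v_1)(v_2)=0$. c) If $\varphi\in V^*$ satisfies $p_1j(\varphi)\ne0$ and $p_0j(\varphi)=0$, then $\rho(S^{-1}(r\varphi))\ne0$ for every positive multiple $r\varphi$ of $\varphi$ lying in the image of $S$; and the same holds with the indices $0$ and $1$ interchanged. Suppose moreover, so that the data below represent an element of $l_0(\{e\})$, that the pairing $\lambda(\varphi,\psi)=\psi(S^{-1}\varphi)$ induced by $S$ (where $S^{-1}$ is taken over $\mathbb Q$) is integral for $\varphi\in\ker p_1j$ and $\psi\in\ker p_0j$ (that is, the two summands of $H\oplus H$ are orthogonal under the linking form of $S$), and that $S(x)(x)$ is even for all $x\in\ker\rho$, so that $\mu(x)=\tfrac12S(x)(x)$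 is defined. (The map $\lambda:\ker p_1j\to(\ker p_0j)^*$ is then automatically an isomorphism.) Then, with $f$ and $g$ the restrictions of $S$ to $\ker\rho$, the element $$(\ker p_1j\xleftarrow{f}\ker\rho\xrightarrow{g}\ker p_0j,\ \lambda)\in l_0(\{e\})$$ is elementary. -/

import Mathlib

open Module

universe u v w

/-! ### The obstruction monoid `l₀({e})`

For the trivial group the group ring is `ℤ` with the trivial involution, and `ε = 1`, so a quadratic
refinement takes its values in `ℤ / ⟨x - x⟩ = ℤ`.  Since `Wh({e}) = 0` (every invertible integer
matrix is a product of elementary matrices and a diagonal matrix with entries `± 1`), any two bases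
of a finitely generated free abelian group are equivalent and every isomorphism is simple; so a
based `ℤ`-module is exactly a finitely generated free abelian group. -/

/-- A representative `(V₀ ←f- V -g→ V₁, λ, μ)` of an element of `l₀({e})`. -/
structure LTriple : Type (u + 1) where
  V₀ : Type u
  V : Type u
  V₁ : Type u
  [grp₀ : AddCommGroup V₀]
  [grp : AddCommGroup V]
  [grp₁ : AddCommGroup V₁]
  [fin : Module.Finite ℤ V]
  [fin₀ : Module.Finite ℤ V₀]
  [free₀ : Module.Free ℤ V₀]
  [fin₁ : Module.Finite ℤ V₁]
  [free₁ : Module.Free ℤ V₁]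
  f : V →ₗ[ℤ] V₀
  g : V →ₗ[ℤ] V₁
  lam : V₀ →ₗ[ℤ] Dual ℤ V₁
  lam_bijective : Function.Bijective lam
  /-- the form `λ_V (x, y) = λ (f x, g y)` induced on `V` is symmetric -/
  lam_symm : ∀ x y : V, lam (f x) (g y) = lam (f y) (g x)
  /-- the quadratic refinement of `λ_V` -/
  mu : V → ℤ
  lam_self : ∀ x : V, lam (f x) (g x) = mu x + mu x
  mu_add : ∀ x y : V, mu (x + y) = mu x + mu y + lam (f x) (g y)
  mu_smul : ∀ (a : ℤ) (x : V), mu (a • x) = a * mu x * a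

namespace LTriple

attribute [instance] grp₀ grp grp₁ fin fin₀ free₀ fin₁ free₁

/-- The orthogonal sum of two triples. -/
def orthogonalSum (T : LTriple.{u}) (T' : LTriple.{v}) : LTriple.{max u v} where
  V₀ := T.V₀ × T'.V₀
  V := T.V × T'.V
  V₁ := T.V₁ × T'.V₁
  f := T.f.prodMap T'.f
  g := T.g.prodMap T'.g
  lam := LinearMap.mk₂ ℤ (fun x y => T.lam x.1 y.1 + T'.lam x.2 y.2)
    (by intro x x' y; simp; ring) (by intro c x y; simp; ring)
    (by intro x y y'; simp; ring) (by intro c x y; simp; ring)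
  lam_bijective := by
    constructor
    · rw [injective_iff_map_eq_zero]
      intro x hx
      have h1 : T.lam x.1 = 0 := by
        ext y; simpa using LinearMap.congr_fun hx (y, 0)
      have h2 : T'.lam x.2 = 0 := by
        ext y; simpa using LinearMap.congr_fun hx (0, y)
      exact Prod.ext ((injective_iff_map_eq_zero _).1 T.lam_bijective.1 _ h1)
        ((injective_iff_map_eq_zero _).1 T'.lam_bijective.1 _ h2)
    · intro χ
      obtain ⟨a, ha⟩ := T.lam_bijective.2 (χ ∘ₗ LinearMap.inl ℤ _ _)
      obtain ⟨b, hb⟩ := T'.lam_bijective.2 (χ ∘ₗ LinearMap.inr ℤ _ _)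
      refine ⟨(a, b), ?_⟩
      ext y
      · simp [ha]
      · simp [hb]
  lam_symm x y := by
    simp [T.lam_symm x.1 y.1, T'.lam_symm x.2 y.2]
  mu x := T.mu x.1 + T'.mu x.2
  lam_self x := by
    simp [T.lam_self, T'.lam_self]; ring
  mu_add x y := by
    simp [T.mu_add, T'.mu_add]; ring
  mu_smul a x := by
    simp [T.mu_smul, T'.mu_smul]; ring

/-- The hyperbolic form on `(ℤ ⊕ ℤ)ʳ`, with `f = g = id`; on each summand, with standard basis
`e = (1, 0)` and `f = (0, 1)`, one has `λ(e, f) = λ(f, e) = 1`, `λ(e, e) = λ(f, f) = 0` and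
`μ(e) = μ(f) = 0`. -/
def hyperbolic (r : ℕ) : LTriple.{0} where
  V₀ := Fin r → ℤ × ℤ
  V := Fin r → ℤ × ℤ
  V₁ := Fin r → ℤ × ℤ
  f := LinearMap.id
  g := LinearMap.id
  lam := LinearMap.mk₂ ℤ (fun x y => ∑ i, ((x i).1 * (y i).2 + (x i).2 * (y i).1))
    (by intro x x' y; rw [← Finset.sum_add_distrib]
        exact Finset.sum_congr rfl fun i _ => by simp; ring)
    (by intro c x y; rw [Finset.smul_sum]
        exact Finset.sum_congr rfl fun i _ => by simp; ring)
    (by intro x y y'; rw [← Finset.sum_add_distrib]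
        exact Finset.sum_congr rfl fun i _ => by simp; ring)
    (by intro c x y; rw [Finset.smul_sum]
        exact Finset.sum_congr rfl fun i _ => by simp; ring)
  lam_bijective := by
    constructor
    · rw [injective_iff_map_eq_zero]
      intro x hx
      funext i
      have h1 := LinearMap.congr_fun hx (Pi.single i (0, 1))
      have h2 := LinearMap.congr_fun hx (Pi.single i (1, 0))
      simp only [LinearMap.mk₂_apply, LinearMap.zero_apply] at h1 h2
      rw [Finset.sum_eq_single i (by intro j _ hj; simp [Pi.single_eq_of_ne hj]) (by simp)] at h1 h2
      simp at h1 h2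
      exact Prod.ext h1 h2
    · intro χ
      refine ⟨fun i => (χ (Pi.single i (0, 1)), χ (Pi.single i (1, 0))), ?_⟩
      refine LinearMap.pi_ext fun i y => ?_
      have hy : (Pi.single i y : Fin r → ℤ × ℤ)
          = y.2 • Pi.single i (0, 1) + y.1 • Pi.single i (1, 0) := by
        rw [← Pi.single_smul, ← Pi.single_smul, ← Pi.single_add]
        simp
      conv_rhs => rw [hy, map_add, map_smul, map_smul]
      rw [LinearMap.mk₂_apply, Finset.sum_eq_single i
        (by intro j _ hj; simp [Pi.single_eq_of_ne hj]) (by simp)]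
      simp
      ring
  lam_symm x y := by
    simp only [LinearMap.mk₂_apply, LinearMap.id_apply]
    exact Finset.sum_congr rfl fun i _ => by ring
  mu x := ∑ i, (x i).1 * (x i).2
  lam_self x := by
    simp only [LinearMap.mk₂_apply, LinearMap.id_apply]
    rw [← Finset.sum_add_distrib]
    exact Finset.sum_congr rfl fun i _ => by ring
  mu_add x y := by
    simp only [LinearMap.mk₂_apply, LinearMap.id_apply]
    rw [← Finset.sum_add_distrib, ← Finset.sum_add_distrib]
    exact Finset.sum_congr rfl fun i _ => by simp; ring
  mu_smul a x := by
    rw [Finset.mul_sum, Finset.sum_mul]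
    exact Finset.sum_congr rfl fun i _ => by simp; ring

/-- Two triples are isometric (a simple isometry, as every isomorphism over `ℤ` is simple). -/
def Isometric (T T' : LTriple.{u}) : Prop :=
  ∃ (e₀ : T.V₀ ≃ₗ[ℤ] T'.V₀) (e : T.V ≃ₗ[ℤ] T'.V) (e₁ : T.V₁ ≃ₗ[ℤ] T'.V₁),
    (∀ x, e₀ (T.f x) = T'.f (e x)) ∧ (∀ x, e₁ (T.g x) = T'.g (e x)) ∧
    (∀ x y, T'.lam (e₀ x) (e₁ y) = T.lam x y) ∧ (∀ x, T'.mu (e x) = T.mu x)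

/-- Two triples are equivalent if they become isometric after adding hyperbolic forms, perhaps of
different rank. -/
def StablyIsometric (T T' : LTriple.{u}) : Prop :=
  ∃ r s : ℕ, Isometric (T.orthogonalSum (hyperbolic r)) (T'.orthogonalSum (hyperbolic s))

/-- The conditions on a submodule `U ⊆ V` which exhibit a triple as elementary. -/
structure IsElementarySubmodule (T : LTriple.{u}) (U : Submodule ℤ T.V) : Prop where
  free : Module.Free ℤ U
  finite : Module.Finite ℤ U
  /-- `U ⊆ U^⊥` -/
  isotropic : ∀ x ∈ U, ∀ y ∈ U, T.lam (T.f x) (T.g y) = 0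
  mu_eq_zero : ∀ x ∈ U, T.mu x = 0
  /-- `U` maps injectively to `V₀` with image `U₀` a direct summand -/
  injOn_f : Set.InjOn T.f U
  summand₀ : ∃ C : Submodule ℤ T.V₀, IsCompl (U.map T.f) C
  /-- `U` maps injectively to `V₁` with image `U₁` a direct summand -/
  injOn_g : Set.InjOn T.g U
  summand₁ : ∃ C : Submodule ℤ T.V₁, IsCompl (U.map T.g) C
  /-- `λ` induces an isomorphism `U₀ → (V₁ / U₁)^*` -/
  lam_iso : ∃ e : U.map T.f ≃ₗ[ℤ] Dual ℤ (T.V₁ ⧸ U.map T.g),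
    ∀ (x : U.map T.f) (y : T.V₁), e x (Submodule.Quotient.mk y) = T.lam x y

end LTriple

/-- The set underlying the monoid `l₀({e})`: triples up to stable isometry. -/
def LZero : Type (u + 1) := Quot LTriple.StablyIsometric.{u}

/-- The class of a triple in `l₀({e})`. -/
def LTriple.toLZero (T : LTriple.{u}) : LZero.{u} := Quot.mk _ T

/-- An element of `l₀({e})` is elementary if it has a representative admitting a submodule `U` as
above. -/
def LZero.IsElementary (θ : LZero.{u}) : Prop :=
  ∃ T : LTriple.{u}, T.toLZero = θ ∧ ∃ U : Submodule ℤ T.V, T.IsElementarySubmodule U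

/-! ### The obstruction of a form with a presented cokernel -/

open scoped TensorProduct in
/-- The signature of a symmetric bilinear form on a finitely generated free abelian group: the
signature of its extension to the reals. -/
noncomputable def intSignature {V : Type*} [AddCommGroup V] (S : LinearMap.BilinForm ℤ V) : ℤ :=
  (sigPos (S.baseChange ℝ).toQuadraticMap : ℤ) - sigNeg (S.baseChange ℝ).toQuadraticMap

section Obstruction

variable {V : Type*} {A : Type*} {H : Type*} [AddCommGroup V] [AddCommGroup A] [AddCommGroup H]

/-- `Ker (p₀ j)` for `j : V^* → H ⊕ H`, where `p₀` is the projection to the first summand. -/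
abbrev kerP₀ (j : Dual ℤ V →ₗ[ℤ] H × H) : Submodule ℤ (Dual ℤ V) :=
  LinearMap.ker (LinearMap.fst ℤ H H ∘ₗ j)

/-- `Ker (p₁ j)` for `j : V^* → H ⊕ H`, where `p₁` is the projection to the second summand. -/
abbrev kerP₁ (j : Dual ℤ V →ₗ[ℤ] H × H) : Submodule ℤ (Dual ℤ V) :=
  LinearMap.ker (LinearMap.snd ℤ H H ∘ₗ j)

/-- The rational form `(φ, ψ) ↦ ψ (S⁻¹ φ)` on `V^*` induced by `S` is integral on
`Ker (p₁ j) × Ker (p₀ j)`; in other words, the two summands of the cokernel `H ⊕ H` of `S` are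
orthogonal for its `ℚ / ℤ`-valued linking form. -/
def PairsIntegrally (S : LinearMap.BilinForm ℤ V) (j : Dual ℤ V →ₗ[ℤ] H × H) : Prop :=
  ∀ φ ∈ kerP₁ j, ∀ ψ ∈ kerP₀ j, ∀ (r : ℤ) (v : V), 0 < r → S v = r • φ → r ∣ ψ v

/-- `φ ↦ S⁻¹ (n φ)` with `n` the order of the cokernel `H ⊕ H` of `S`. -/
noncomputable def scaledInverse [Finite H] (S : LinearMap.BilinForm ℤ V)
    (j : Dual ℤ V →ₗ[ℤ] H × H) (hS : Function.Injective S) (hex : Function.Exact S j) :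
    Dual ℤ V →ₗ[ℤ] V :=
  (LinearEquiv.ofInjective S hS).symm.toLinearMap ∘ₗ
    ((Nat.card (H × H) : ℤ) • (LinearMap.id : Dual ℤ V →ₗ[ℤ] Dual ℤ V)).codRestrict
      (LinearMap.range S) (fun φ => by
        refine (hex _).1 ?_
        rw [LinearMap.smul_apply, LinearMap.id_apply, map_smul, natCast_zsmul]
        exact card_nsmul_eq_zero')

variable [Finite H] {S : LinearMap.BilinForm ℤ V} {j : Dual ℤ V →ₗ[ℤ] H × H}

theorem apply_scaledInverse (hS : Function.Injective S) (hex : Function.Exact S j)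
    (φ : Dual ℤ V) : S (scaledInverse S j hS hex φ) = (Nat.card (H × H) : ℤ) • φ := by
  have h := LinearEquiv.apply_symm_apply (LinearEquiv.ofInjective S hS)
    (((Nat.card (H × H) : ℤ) • (LinearMap.id : Dual ℤ V →ₗ[ℤ] Dual ℤ V)).codRestrict
      (LinearMap.range S) (fun φ => by
        refine (hex _).1 ?_
        rw [LinearMap.smul_apply, LinearMap.id_apply, map_smul, natCast_zsmul]
        exact card_nsmul_eq_zero') φ)
  exact congrArg Subtype.val h

theorem card_prod_pos {H : Type*} [AddCommGroup H] [Finite H] : (0 : ℤ) < Nat.card (H × H) := by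
  exact_mod_cast Nat.card_pos

theorem card_dvd_scaledInverse (hS : Function.Injective S) (hex : Function.Exact S j)
    (hint : PairsIntegrally S j) (φ : kerP₁ j) (ψ : kerP₀ j) :
    (Nat.card (H × H) : ℤ) ∣ ψ.1 (scaledInverse S j hS hex φ.1) :=
  hint φ.1 φ.2 ψ.1 ψ.2 _ _ card_prod_pos (apply_scaledInverse hS hex φ.1)

/-- The pairing `λ : Ker (p₁ j) → Ker (p₀ j)^*`, `λ(φ, ψ) = ψ (S⁻¹ φ)`, induced by `S`. -/
noncomputable def inducedPairing (hS : Function.Injective S) (hex : Function.Exact S j)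
    (hint : PairsIntegrally S j) : kerP₁ j →ₗ[ℤ] Dual ℤ (kerP₀ j) :=
  LinearMap.mk₂ ℤ
    (fun φ ψ => ψ.1 (scaledInverse S j hS hex φ.1) / (Nat.card (H × H) : ℤ))
    (by
      intro φ φ' ψ
      rw [Submodule.coe_add, map_add, map_add,
        Int.add_ediv_of_dvd_left (card_dvd_scaledInverse hS hex hint φ ψ)])
    (by
      intro c φ ψ
      rw [Submodule.coe_smul, map_smul, map_smul, smul_eq_mul, smul_eq_mul,
        Int.mul_ediv_assoc _ (card_dvd_scaledInverse hS hex hint φ ψ)])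
    (by
      intro φ ψ ψ'
      rw [Submodule.coe_add, LinearMap.add_apply,
        Int.add_ediv_of_dvd_left (card_dvd_scaledInverse hS hex hint φ ψ)])
    (by
      intro c φ ψ
      rw [Submodule.coe_smul, LinearMap.smul_apply, smul_eq_mul, smul_eq_mul,
        Int.mul_ediv_assoc _ (card_dvd_scaledInverse hS hex hint φ ψ)])

/-- The defining property of `λ`: if `r φ = S v`, then `r λ(φ, ψ) = ψ(v)`. -/
theorem inducedPairing_spec (hS : Function.Injective S) (hex : Function.Exact S j)
    (hint : PairsIntegrally S j) (φ : kerP₁ j) (ψ : kerP₀ j) {r : ℤ} {v : V}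
    (h : S v = r • φ.1) : r * inducedPairing hS hex hint φ ψ = ψ.1 v := by
  have hn : (Nat.card (H × H) : ℤ) ≠ 0 := card_prod_pos.ne'
  have hv : (Nat.card (H × H) : ℤ) • v = r • scaledInverse S j hS hex φ.1 := by
    apply hS
    rw [map_smul, map_smul, apply_scaledInverse, h, smul_comm]
  have hψ := congrArg ψ.1 hv
  rw [map_smul, map_smul, smul_eq_mul, smul_eq_mul] at hψ
  apply mul_left_cancel₀ hn
  rw [hψ, mul_left_comm]
  congr 1
  exact Int.mul_ediv_cancel' (card_dvd_scaledInverse hS hex hint φ ψ)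

theorem inducedPairing_apply_S (hS : Function.Injective S) (hex : Function.Exact S j)
    (hint : PairsIntegrally S j) (φ : kerP₁ j) (ψ : kerP₀ j) {v : V} (h : φ.1 = S v) :
    inducedPairing hS hex hint φ ψ = ψ.1 v := by
  have h1 := inducedPairing_spec hS hex hint φ ψ (r := 1) (v := v) (by rw [h, one_smul])
  rwa [one_mul] at h1

theorem inducedPairing_bijective [Module.Free ℤ V] (hsymm : S.IsSymm) (hS : Function.Injective S)
    (hex : Function.Exact S j) (hj : Function.Surjective j) (hint : PairsIntegrally S j) :
    Function.Bijective (inducedPairing hS hex hint) := by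
  have hn : (Nat.card (H × H) : ℤ) ≠ 0 := card_prod_pos.ne'
  have hmem₀ : ∀ w, S w ∈ kerP₀ j := fun w => by
    simp [show j (S w) = 0 from (hex _).2 ⟨w, rfl⟩]
  constructor
  · rw [injective_iff_map_eq_zero]
    intro φ hφ
    have hv : scaledInverse S j hS hex φ.1 = 0 := by
      apply hS
      rw [map_zero]
      ext w
      have h1 := inducedPairing_spec hS hex hint φ ⟨S w, hmem₀ w⟩ (apply_scaledInverse hS hex φ.1)
      rw [hφ, LinearMap.zero_apply, mul_zero] at h1
      exact (hsymm.eq (scaledInverse S j hS hex φ.1) w).trans h1.symm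
    have h2 := apply_scaledInverse hS hex φ.1
    rw [hv, map_zero] at h2
    apply Subtype.ext
    ext w
    have h3 := LinearMap.congr_fun h2 w
    rw [LinearMap.zero_apply, LinearMap.smul_apply, smul_eq_mul] at h3
    exact (mul_eq_zero.1 h3.symm).resolve_left hn
  · intro χ
    let φ : Dual ℤ V := χ ∘ₗ S.codRestrict (kerP₀ j) hmem₀
    have hφ : ∀ w, φ w = χ ⟨S w, hmem₀ w⟩ := fun w => rfl
    -- `φ` pairs with `ψ ∈ Ker (p₀ j)` to `χ ψ`
    have key : ∀ ψ : kerP₀ j,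
        ψ.1 (scaledInverse S j hS hex φ) = (Nat.card (H × H) : ℤ) * χ ψ := by
      intro ψ
      have e1 : (⟨S (scaledInverse S j hS hex ψ.1), hmem₀ _⟩ : kerP₀ j)
          = (Nat.card (H × H) : ℤ) • ψ := Subtype.ext (apply_scaledInverse hS hex ψ.1)
      have e2 := hφ (scaledInverse S j hS hex ψ.1)
      rw [e1, map_smul, smul_eq_mul] at e2
      apply mul_left_cancel₀ hn
      rw [← e2]
      have e3 := LinearMap.congr_fun (apply_scaledInverse hS hex φ) (scaledInverse S j hS hex ψ.1)
      have e4 := LinearMap.congr_fun (apply_scaledInverse hS hex ψ.1) (scaledInverse S j hS hex φ)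
      rw [LinearMap.smul_apply, smul_eq_mul] at e3 e4
      rw [← e3, ← e4]
      exact hsymm.eq _ _
    -- decompose `φ = φ₁ + φ₀`
    obtain ⟨φ₁, hφ₁⟩ := hj ((j φ).1, 0)
    have hφ₁m : φ₁ ∈ kerP₁ j := by simp [hφ₁]
    have hφ₀m : φ - φ₁ ∈ kerP₀ j := by simp [hφ₁]
    -- `φ₀` pairs integrally with everything, so it lies in the image of `S`
    have hdvd : ∀ ψ : Dual ℤ V,
        (Nat.card (H × H) : ℤ) ∣ ψ (scaledInverse S j hS hex (φ - φ₁)) := by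
      intro ψ
      obtain ⟨ψ₁, hψ₁⟩ := hj ((j ψ).1, 0)
      have hψ₁m : ψ₁ ∈ kerP₁ j := by simp [hψ₁]
      have hψ₀m : ψ - ψ₁ ∈ kerP₀ j := by simp [hψ₁]
      have d1 : (Nat.card (H × H) : ℤ) ∣ (ψ - ψ₁) (scaledInverse S j hS hex (φ - φ₁)) := by
        rw [map_sub, map_sub]
        refine dvd_sub ?_ (card_dvd_scaledInverse hS hex hint ⟨φ₁, hφ₁m⟩ ⟨ψ - ψ₁, hψ₀m⟩)
        exact ⟨_, key ⟨ψ - ψ₁, hψ₀m⟩⟩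
      have d2 : (Nat.card (H × H) : ℤ) ∣ ψ₁ (scaledInverse S j hS hex (φ - φ₁)) := by
        have d3 := card_dvd_scaledInverse hS hex hint ⟨ψ₁, hψ₁m⟩ ⟨φ - φ₁, hφ₀m⟩
        have e3 := LinearMap.congr_fun (apply_scaledInverse hS hex (φ - φ₁))
          (scaledInverse S j hS hex ψ₁)
        have e4 := LinearMap.congr_fun (apply_scaledInverse hS hex ψ₁)
          (scaledInverse S j hS hex (φ - φ₁))
        rw [LinearMap.smul_apply, smul_eq_mul] at e3 e4
        have e5 : (φ - φ₁) (scaledInverse S j hS hex ψ₁)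
            = ψ₁ (scaledInverse S j hS hex (φ - φ₁)) := by
          apply mul_left_cancel₀ hn
          rw [← e3, ← e4]
          exact hsymm.eq _ _
        rw [← e5]
        exact d3
      have := dvd_add d1 d2
      rwa [LinearMap.sub_apply, sub_add_cancel] at this
    have hj0 : j (φ - φ₁) = 0 := by
      obtain ⟨u, hu⟩ : ∃ u : V, (Nat.card (H × H) : ℤ) • u
          = scaledInverse S j hS hex (φ - φ₁) := by
        let b := Module.Free.chooseBasis ℤ V
        refine ⟨b.repr.symm ((b.repr (scaledInverse S j hS hex (φ - φ₁))).mapRange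
          (fun z : ℤ => z / (Nat.card (H × H) : ℤ)) (Int.zero_ediv _)), ?_⟩
        apply b.ext_elem
        intro i
        rw [map_smul, LinearEquiv.apply_symm_apply, Finsupp.smul_apply, Finsupp.mapRange_apply,
          smul_eq_mul]
        exact Int.mul_ediv_cancel' (hdvd (b.coord i))
      refine (hex _).2 ⟨u, ?_⟩
      have h6 := apply_scaledInverse hS hex (φ - φ₁)
      rw [← hu, map_smul] at h6
      exact smul_right_injective _ hn h6
    have hφm : φ ∈ kerP₁ j := by
      have : j φ = j φ₁ := by rwa [map_sub, sub_eq_zero] at hj0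
      exact congrArg Prod.snd (this.trans hφ₁)
    refine ⟨⟨φ, hφm⟩, ?_⟩
    ext ψ
    apply mul_left_cancel₀ hn
    rw [inducedPairing_spec hS hex hint ⟨φ, hφm⟩ ψ (apply_scaledInverse hS hex φ)]
    exact key ψ

/-- The triple `(Ker (p₁ j) ←f- Ker ρ -g→ Ker (p₀ j), λ, μ)`: the maps `f` and `g` are the
restrictions of `S`, the pairing `λ` is induced by `S`, and `μ(x) = S(x, x) / 2` is the only possible
quadratic refinement, which exists if `S` is even on `Ker ρ`. -/
noncomputable def obstructionTriple {V : Type u} {A H : Type*} [AddCommGroup V] [AddCommGroup A]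
    [AddCommGroup H] [Module.Finite ℤ V] [Module.Free ℤ V] [Finite H]
    (S : LinearMap.BilinForm ℤ V) (ρ : V →ₗ[ℤ] A) (j : Dual ℤ V →ₗ[ℤ] H × H)
    (hsymm : S.IsSymm) (hS : Function.Injective S) (hex : Function.Exact S j)
    (hj : Function.Surjective j) (hint : PairsIntegrally S j)
    (heven : ∀ v ∈ LinearMap.ker ρ, Even (S v v)) : LTriple.{u} where
  V₀ := kerP₁ j
  V := LinearMap.ker ρ
  V₁ := kerP₀ j
  f := (S ∘ₗ (LinearMap.ker ρ).subtype).codRestrict (kerP₁ j)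
    (fun v => by simp [show j (S v) = 0 from (hex _).2 ⟨v, rfl⟩])
  g := (S ∘ₗ (LinearMap.ker ρ).subtype).codRestrict (kerP₀ j)
    (fun v => by simp [show j (S v) = 0 from (hex _).2 ⟨v, rfl⟩])
  lam := inducedPairing hS hex hint
  lam_bijective := inducedPairing_bijective hsymm hS hex hj hint
  lam_symm x y := by
    rw [inducedPairing_apply_S hS hex hint _ _ (v := x.1) rfl,
      inducedPairing_apply_S hS hex hint _ _ (v := y.1) rfl]
    exact hsymm.eq y.1 x.1
  mu x := S x.1 x.1 / 2
  lam_self x := by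
    rw [inducedPairing_apply_S hS hex hint _ _ (v := x.1) rfl]
    obtain ⟨a, ha⟩ := heven x.1 x.2
    change S x.1 x.1 = _
    omega
  mu_add x y := by
    rw [inducedPairing_apply_S hS hex hint _ _ (v := x.1) rfl]
    obtain ⟨a, ha⟩ := heven x.1 x.2
    obtain ⟨b, hb⟩ := heven y.1 y.2
    have hxy : S x.1 y.1 = S y.1 x.1 := hsymm.eq x.1 y.1
    change S (x.1 + y.1) (x.1 + y.1) / 2 = S x.1 x.1 / 2 + S y.1 y.1 / 2 + S y.1 x.1
    rw [LinearMap.map_add₂, map_add, map_add]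
    omega
  mu_smul a x := by
    obtain ⟨b, hb⟩ := heven x.1 x.2
    change S (a • x.1) (a • x.1) / 2 = a * (S x.1 x.1 / 2) * a
    rw [LinearMap.map_smul₂, map_smul, smul_eq_mul, smul_eq_mul, hb,
      show a * (a * (b + b)) = 2 * (a * b * a) by ring, show b + b = 2 * b by ring]
    simp

end Obstruction

/-!
The obstruction is elementary because `K = Ker ρ` contains a subgroup `U` which is isotropic for `S`
and is its own orthogonal complement in `V` (`exists_lagrangian_le_ker`).  Such a `U` exhibits the
given triple itself as elementary, without stabilization
(`isElementarySubmodule_of_lagrangian`): by `hc₀` and `hc₁`, `S(K)` has torsion-free quotient in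
both `Ker (p₁ j)` and `Ker (p₀ j)`, so the images of `U` are direct summands, and `λ` is an
isomorphism.

To find `U`, let `R` be the orthogonal complement of `K`.  By `hb`, `R ⊆ K`, and
`K = R ⊕ M` for some `M`.  Since `S(K)` is a summand and `λ` is an isomorphism, every functional on
`M` is of the form `S(m, -)`, so the form on `M` is unimodular.  The image of `K` in `V ⊕ (-M)` is
isotropic of half the rank, so `M` has the signature of `V`, namely zero.  Hence it suffices that a
unimodular form `M` over `ℤ` of signature zero has a Lagrangian
(`exists_eq_orthogonal_of_unimodular`); the preimage of this Lagrangian in `K` is `U`.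

That statement amounts to the computation `W(ℤ) = ℤ` of the Witt group, and the proof follows Milnor
and Tate.  The class of `M` in `W(ℚ)` is a sum of classes `⟨u⟩`, where `u` only involves primes up to
some `k`, and `k` is lowered to `1`.  If `k = p` is prime, then division with remainder shows that
modulo forms which only involve primes smaller than `p`, the class `⟨p u⟩` only depends on `u` modulo
`p` and satisfies the relations of the Witt group of `𝔽_p`.  So `M` is Witt equivalent to
`D' ⊕ p D`, where `D` is anisotropic modulo `p` and `D'` only involves primes smaller than `p`
(`exists_anisotropic_residue`).  As `M` and `D'` are nondegenerate modulo `p`, the reduction modulo `p`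
of a rational Lagrangian of `M ⊕ (-D') ⊕ (-p D)` shows that `D = 0` (`isEmpty_of_anisotropic`).
For `k = 1`, the class of `M` is a multiple of `⟨1⟩`, and it is zero as the signature is zero.
-/

/-! ### Lagrangians of rational quadratic forms -/

section Lagrangian

variable {X Y : Type*} [AddCommGroup X] [Module ℚ X] [AddCommGroup Y] [Module ℚ Y]

/-- A rational quadratic form has a Lagrangian if it vanishes on a subspace of at least half the
dimension.  For nondegenerate forms the dimension is then exactly half, and this says that the class
of the form in the Witt group `W(ℚ)` is zero. -/
def HasLagrangian (q : QuadraticForm ℚ X) : Prop :=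
  ∃ W : Submodule ℚ X, (∀ x ∈ W, q x = 0) ∧ finrank ℚ X ≤ 2 * finrank ℚ W

theorem HasLagrangian.of_equivalent {q : QuadraticForm ℚ X} {q' : QuadraticForm ℚ Y}
    (e : q.Equivalent q') (h : HasLagrangian q) : HasLagrangian q' := by
  obtain ⟨e⟩ := e
  obtain ⟨W, hW, hd⟩ := h
  refine ⟨W.map e.toLinearEquiv.toLinearMap, ?_, ?_⟩
  · rintro _ ⟨x, hx, rfl⟩
    exact (e.map_app x).trans (hW x hx)
  · rw [LinearEquiv.finrank_map_eq, ← e.toLinearEquiv.finrank_eq]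
    exact hd

theorem HasLagrangian.of_injective {q : QuadraticForm ℚ X} [FiniteDimensional ℚ X]
    (φ : Y →ₗ[ℚ] X) (hφ : Function.Injective φ) (h0 : ∀ y, q (φ y) = 0)
    (hd : finrank ℚ X ≤ 2 * finrank ℚ Y) : HasLagrangian q := by
  refine ⟨LinearMap.range φ, ?_, ?_⟩
  · rintro _ ⟨y, rfl⟩
    exact h0 y
  · rwa [LinearMap.finrank_range_of_inj hφ]

theorem QuadraticMap.polar_eq_zero_of_isotropic {q : QuadraticForm ℚ X} {W : Submodule ℚ X}
    (hW : ∀ x ∈ W, q x = 0) {x y : X} (hx : x ∈ W) (hy : y ∈ W) : QuadraticMap.polar q x y = 0 := by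
  simp [QuadraticMap.polar, hW _ (W.add_mem hx hy), hW _ hx, hW _ hy]

theorem HasLagrangian.prod {q : QuadraticForm ℚ X} {q' : QuadraticForm ℚ Y}
    [FiniteDimensional ℚ X] [FiniteDimensional ℚ Y]
    (h : HasLagrangian q) (h' : HasLagrangian q') : HasLagrangian (q.prod q') := by
  obtain ⟨W, hW, hd⟩ := h
  obtain ⟨W', hW', hd'⟩ := h'
  refine .of_injective (W.subtype.prodMap W'.subtype)
    (W.injective_subtype.prodMap W'.injective_subtype) ?_ ?_
  · rintro ⟨x, y⟩
    simp [QuadraticMap.prod_apply, hW x x.2, hW' y y.2]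
  · rw [finrank_prod, finrank_prod]
    omega

theorem finrank_comap_fst [FiniteDimensional ℚ X] [FiniteDimensional ℚ Y] (P : Submodule ℚ X) :
    finrank ℚ (P.comap (LinearMap.fst ℚ X Y)) = finrank ℚ P + finrank ℚ Y := by
  have h := LinearMap.finrank_range_add_finrank_ker (P.mkQ ∘ₗ LinearMap.fst ℚ X Y)
  have hsurj : Function.Surjective (P.mkQ ∘ₗ LinearMap.fst ℚ X Y) := by
    rw [LinearMap.coe_comp]
    exact P.mkQ_surjective.comp LinearMap.fst_surjective
  rw [LinearMap.range_eq_top.2 hsurj, finrank_top, LinearMap.ker_comp, P.ker_mkQ, finrank_prod] at h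
  have := P.finrank_quotient_add_finrank
  omega

/-- Witt cancellation for metabolic forms: if `L` is a Lagrangian of `q` and `M` one of `q ⊕ q'`, then
`{y | ∃ x ∈ L, (x, y) ∈ M}` is a Lagrangian of `q'`. -/
theorem HasLagrangian.of_prod {q : QuadraticForm ℚ X} {q' : QuadraticForm ℚ Y}
    [FiniteDimensional ℚ X] [FiniteDimensional ℚ Y] (hq : q.polarBilin.Nondegenerate)
    (h : HasLagrangian q) (h' : HasLagrangian (q.prod q')) : HasLagrangian q' := by
  obtain ⟨L, hL, hLd⟩ := h
  obtain ⟨M, hM, hMd⟩ := h'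
  let Z : Submodule ℚ X := L ⊓ M.comap (LinearMap.inl ℚ X Y)
  let Zp : Submodule ℚ X := LinearMap.BilinForm.orthogonal q.polarBilin Z
  let P : Submodule ℚ (X × Y) := L.comap (LinearMap.fst ℚ X Y)
  have hMP : M ⊔ P ≤ Zp.comap (LinearMap.fst ℚ X Y) := by
    refine sup_le ?_ ?_
    · rintro ⟨x, y⟩ hxy z hz
      have h1 := QuadraticMap.polar_eq_zero_of_isotropic hM hz.2 hxy
      simpa using h1
    · rintro ⟨x, y⟩ hxy z hz
      exact QuadraticMap.polar_eq_zero_of_isotropic hL hz.1 hxy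
  have h1 := Submodule.finrank_mono hMP
  have h2 := Submodule.finrank_sup_add_finrank_inf_eq M P
  rw [finrank_comap_fst, LinearMap.BilinForm.finrank_orthogonal hq] at h1
  rw [finrank_comap_fst] at h2
  have h3 := LinearMap.finrank_range_add_finrank_ker
    ((LinearMap.snd ℚ X Y) ∘ₗ (M ⊓ P).subtype)
  have h4 : finrank ℚ (LinearMap.ker ((LinearMap.snd ℚ X Y) ∘ₗ (M ⊓ P).subtype)) ≤ finrank ℚ Z := by
    refine LinearMap.finrank_le_finrank_of_injective
      (f := (((LinearMap.fst ℚ X Y) ∘ₗ (M ⊓ P).subtype ∘ₗ Submodule.subtype _).codRestrict Z ?_)) ?_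
    · rintro ⟨⟨⟨x, y⟩, hx1, hx2⟩, hy⟩
      have hy' : y = 0 := by simpa using hy
      subst hy'
      exact ⟨hx2, hx1⟩
    · rintro ⟨⟨⟨x, y⟩, hx⟩, hy⟩ ⟨⟨⟨x', y'⟩, hx'⟩, hy'⟩ he
      have e1 : x = x' := congrArg Subtype.val he
      have e2 : y = 0 := by simpa using hy
      have e3 : y' = 0 := by simpa using hy'
      subst e1 e2 e3
      rfl
  have h5 : finrank ℚ Z ≤ finrank ℚ X := Submodule.finrank_le _
  refine ⟨LinearMap.range ((LinearMap.snd ℚ X Y) ∘ₗ (M ⊓ P).subtype), ?_, ?_⟩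
  · rintro _ ⟨⟨⟨x, y⟩, hx⟩, rfl⟩
    have h6 := hM _ hx.1
    rw [QuadraticMap.prod_apply, hL x hx.2, zero_add] at h6
    exact h6
  · rw [finrank_prod] at hMd
    omega

end Lagrangian

/-! ### Diagonal forms and their classes -/

section Diagonal

variable {ι κ : Type*} [Fintype ι] [Fintype κ]

/-- The diagonal rational quadratic form with coefficients `a`. -/
noncomputable abbrev diagForm (a : ι → ℚˣ) : QuadraticForm ℚ (ι → ℚ) :=
  QuadraticMap.weightedSumSquares ℚ (fun i => (a i : ℚ))

theorem diagForm_nondegenerate (a : ι → ℚˣ) : (diagForm a).polarBilin.Nondegenerate := by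
  rw [QuadraticMap.nondegenerate_polar_iff]
  rw [QuadraticMap.nondegenerate_iff_radical_eq_bot, QuadraticForm.radical_weightedSumSquares]
  ext x
  simp [Pi.mem_spanSubset_iff, funext_iff]

theorem diagForm_sumElim (a : ι → ℚˣ) (b : κ → ℚˣ) :
    (diagForm (Sum.elim a b)).Equivalent ((diagForm a).prod (diagForm b)) :=
  ⟨{ LinearEquiv.sumArrowLequivProdArrow ι κ ℚ ℚ with
      map_app' := fun x => by
        simp [QuadraticMap.prod_apply, LinearEquiv.sumArrowLequivProdArrow] }⟩

theorem diagForm_comp_equiv (a : κ → ℚˣ) (e : ι ≃ κ) :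
    (diagForm (a ∘ e)).Equivalent (diagForm a) :=
  ⟨{ LinearEquiv.funCongrLeft ℚ ℚ e.symm with
      map_app' := fun x => by
        simp only [QuadraticMap.weightedSumSquares_apply]
        refine (Fintype.sum_equiv e _ _ fun i => ?_).symm
        simp [LinearEquiv.funCongrLeft] }⟩

end Diagonal

/-! ### The Witt group of the rational numbers -/

section WittRelations

variable {ι κ : Type*} [Fintype ι] [Fintype κ]

theorem exists_equiv_of_sum_single_eq {α : Type*} (a : ι → α) (b : κ → α)
    (h : ∑ i, Finsupp.single (a i) (1 : ℤ) = ∑ j, Finsupp.single (b j) (1 : ℤ)) :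
    ∃ e : ι ≃ κ, b ∘ e = a := by
  classical
  have hcard : ∀ u, Nonempty ({i // a i = u} ≃ {j // b j = u}) := by
    intro u
    have h1 := DFunLike.congr_fun h u
    simp only [Finsupp.coe_finsetSum, Finset.sum_apply, Finsupp.single_apply,
      Finset.sum_boole] at h1
    rw [← Fintype.card_eq, Fintype.card_subtype, Fintype.card_subtype]
    exact_mod_cast h1
  have f := fun u => (hcard u).some
  refine ⟨((Equiv.sigmaFiberEquiv a).symm.trans (Equiv.sigmaCongrRight f)).trans
    (Equiv.sigmaFiberEquiv b), ?_⟩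
  funext i
  exact (f (a i) ⟨i, rfl⟩).2

/-- The formal sum of the coefficients of a diagonal form, in the free abelian group on `ℚˣ`. -/
noncomputable def diagClass (a : ι → ℚˣ) : ℚˣ →₀ ℤ := ∑ i, Finsupp.single (a i) 1

theorem diagClass_sumElim (a : ι → ℚˣ) (b : κ → ℚˣ) :
    diagClass (Sum.elim a b) = diagClass a + diagClass b := by
  simp [diagClass]

theorem hasLagrangian_sumElim {a : ι → ℚˣ} {b : κ → ℚˣ} (ha : HasLagrangian (diagForm a))
    (hb : HasLagrangian (diagForm b)) : HasLagrangian (diagForm (Sum.elim a b)) :=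
  (ha.prod hb).of_equivalent (diagForm_sumElim a b).symm

/-- The relations of the Witt group: differences of classes of diagonal forms with Lagrangians.  The
quotient of the free abelian group on `ℚˣ` by this subgroup is `W(ℚ)`. -/
noncomputable def wittRelations : AddSubgroup (ℚˣ →₀ ℤ) where
  carrier := {x | ∃ (n m : ℕ) (a : Fin n → ℚˣ) (b : Fin m → ℚˣ),
    HasLagrangian (diagForm a) ∧ HasLagrangian (diagForm b) ∧ x = diagClass a - diagClass b}
  zero_mem' := by
    refine ⟨0, 0, Fin.elim0, Fin.elim0, ?_, ?_, by simp⟩ <;>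
      exact ⟨⊥, by simp, by simp⟩
  add_mem' := by
    rintro _ _ ⟨n, m, a, b, ha, hb, rfl⟩ ⟨n', m', a', b', ha', hb', rfl⟩
    refine ⟨n + n', m + m', Sum.elim a a' ∘ finSumFinEquiv.symm,
      Sum.elim b b' ∘ finSumFinEquiv.symm,
      (hasLagrangian_sumElim ha ha').of_equivalent (diagForm_comp_equiv _ _).symm,
      (hasLagrangian_sumElim hb hb').of_equivalent (diagForm_comp_equiv _ _).symm, ?_⟩
    have key : ∀ {k l : ℕ} (c : Fin k → ℚˣ) (d : Fin l → ℚˣ),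
        diagClass (Sum.elim c d ∘ finSumFinEquiv.symm) = diagClass c + diagClass d := by
      intro k l c d
      rw [← diagClass_sumElim]
      exact Equiv.sum_comp finSumFinEquiv.symm (fun i => Finsupp.single (Sum.elim c d i) (1 : ℤ))
    rw [key, key]
    abel
  neg_mem' := by
    rintro _ ⟨n, m, a, b, ha, hb, rfl⟩
    exact ⟨m, n, b, a, hb, ha, by abel⟩

theorem diagClass_comp_equiv (a : κ → ℚˣ) (e : ι ≃ κ) : diagClass (a ∘ e) = diagClass a :=
  Equiv.sum_comp e (fun i => Finsupp.single (a i) (1 : ℤ))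

/-- A diagonal form represents zero in the Witt group only if it has a Lagrangian. -/
theorem diagClass_mem_wittRelations {a : ι → ℚˣ} :
    diagClass a ∈ wittRelations ↔ HasLagrangian (diagForm a) := by
  constructor
  · rintro ⟨n, m, b, c, hb, hc, h⟩
    have h1 : diagClass (Sum.elim c a) = diagClass b := by
      rw [diagClass_sumElim, h]
      abel
    obtain ⟨e, he⟩ := exists_equiv_of_sum_single_eq _ _ h1
    have h2 : HasLagrangian (diagForm (Sum.elim c a)) :=
      he ▸ hb.of_equivalent (diagForm_comp_equiv b e).symm
    exact .of_prod (diagForm_nondegenerate c) hc (h2.of_equivalent (diagForm_sumElim c a))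
  · intro h
    let e := (Fintype.equivFin ι).symm
    refine ⟨Fintype.card ι, 0, a ∘ e, Fin.elim0, h.of_equivalent (diagForm_comp_equiv a e).symm,
      ⟨⊥, by simp, by simp⟩, ?_⟩
    rw [diagClass_comp_equiv]
    simp [diagClass]

theorem single_add_single_neg_mem (u : ℚˣ) :
    Finsupp.single u 1 + Finsupp.single (-u) 1 ∈ wittRelations := by
  have h : HasLagrangian (diagForm ![u, -u]) := by
    refine .of_injective (Y := ℚ) (LinearMap.pi ![LinearMap.id, LinearMap.id]) ?_ ?_ (by simp)
    · intro x y hxy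
      simpa using congrFun hxy 0
    · intro y
      simp [Fin.sum_univ_two]
  simpa [diagClass, Fin.sum_univ_two] using diagClass_mem_wittRelations.2 h

theorem single_mul_sq_sub_mem (u c : ℚˣ) :
    Finsupp.single (u * c ^ 2) 1 - Finsupp.single u 1 ∈ wittRelations := by
  have h : HasLagrangian (diagForm ![u * c ^ 2, -u]) := by
    refine .of_injective (Y := ℚ)
      (LinearMap.pi ![LinearMap.id, (c : ℚ) • LinearMap.id]) ?_ ?_ (by simp)
    · intro x y hxy
      simpa using congrFun hxy 0
    · intro y
      simp [Fin.sum_univ_two]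
      ring
  have h1 := diagClass_mem_wittRelations.2 h
  simp only [diagClass, Fin.sum_univ_two, Matrix.cons_val_zero, Matrix.cons_val_one] at h1
  have h2 := sub_mem h1 (single_add_single_neg_mem u)
  convert h2 using 1
  abel

/-- The relation `⟨a⟩ + ⟨b⟩ = ⟨a + b⟩ + ⟨a b (a + b)⟩` in the Witt group. -/
theorem single_add_single_sub_mem (a b c : ℚˣ) (h : (a : ℚ) + b = c) :
    Finsupp.single a 1 + Finsupp.single b 1
      - (Finsupp.single c 1 + Finsupp.single (a * b * c) 1) ∈ wittRelations := by
  have h0 : HasLagrangian (diagForm ![a, b, -c, -(a * b * c)]) := by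
    refine .of_injective (Y := ℚ × ℚ)
      (LinearMap.pi ![LinearMap.fst ℚ ℚ ℚ + (b : ℚ) • LinearMap.snd ℚ ℚ ℚ,
        LinearMap.fst ℚ ℚ ℚ - (a : ℚ) • LinearMap.snd ℚ ℚ ℚ, LinearMap.fst ℚ ℚ ℚ,
        LinearMap.snd ℚ ℚ ℚ]) ?_ ?_ (by simp)
    · intro x y hxy
      have h1 := congrFun hxy 2
      have h2 := congrFun hxy 3
      exact Prod.ext (by simpa using h1) (by simpa using h2)
    · intro y
      simp [Fin.sum_univ_four, ← h]
      ring
  have h1 := diagClass_mem_wittRelations.2 h0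
  simp [diagClass, Fin.sum_univ_four] at h1
  have h2 := sub_mem (sub_mem h1 (single_add_single_neg_mem c)) (single_add_single_neg_mem (a * b * c))
  convert h2 using 1
  abel

/-- The sum of the signs of the coefficients. -/
noncomputable def signatureHom : (ℚˣ →₀ ℤ) →+ ℤ :=
  Finsupp.liftAddHom fun u => AddMonoidHom.mulLeft (SignType.sign (u : ℚ) : ℤ)

theorem signatureHom_single (u : ℚˣ) :
    signatureHom (Finsupp.single u 1) = (SignType.sign (u : ℚ) : ℤ) := by
  simp [signatureHom]

theorem signatureHom_diagClass (a : ι → ℚˣ) :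
    signatureHom (diagClass a) = (sigPos (diagForm a) : ℤ) - sigNeg (diagForm a) := by
  classical
  rw [QuadraticForm.sigPos_weightedSumSquares, QuadraticForm.sigNeg_weightedSumSquares, diagClass,
    map_sum, Set.ncard_eq_toFinset_card', Set.ncard_eq_toFinset_card', Set.toFinset_ofPred,
    Set.toFinset_ofPred, ← Finset.sum_boole, ← Finset.sum_boole, ← Finset.sum_sub_distrib]
  refine Finset.sum_congr rfl fun i _ => ?_
  rw [signatureHom_single]
  rcases lt_or_gt_of_ne (a i).ne_zero with h | h
  · simp [h, h.not_gt, sign_neg h]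
  · simp [h, h.not_gt, sign_pos h]

theorem HasLagrangian.sigPos_eq_sigNeg {X : Type*} [AddCommGroup X] [Module ℚ X]
    [FiniteDimensional ℚ X] {q : QuadraticForm ℚ X} (hq : q.Nondegenerate)
    (h : HasLagrangian q) : sigPos q = sigNeg q := by
  obtain ⟨W, hW, hd⟩ := h
  have h1 := QuadraticForm.sigPos_add_finrank_le_of_nonpos (Q := q) fun x hx => (hW x hx).le
  have h2 := QuadraticForm.sigPos_add_finrank_le_of_nonpos (Q := -q) (V := W) fun x hx => by
    simp [hW x hx]
  have h3 := QuadraticForm.sigPos_add_sigNeg_add_radical (Q := q)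
  rw [hq.radical_eq_bot, finrank_bot] at h3
  rw [sigPos_neg] at h2
  omega

/-- The signature is an invariant of the Witt class. -/
theorem signatureHom_eq_zero_of_mem {x : ℚˣ →₀ ℤ} (hx : x ∈ wittRelations) :
    signatureHom x = 0 := by
  obtain ⟨n, m, a, b, ha, hb, rfl⟩ := hx
  rw [map_sub, signatureHom_diagClass, signatureHom_diagClass,
    ha.sigPos_eq_sigNeg (QuadraticMap.nondegenerate_polar_iff.1 (diagForm_nondegenerate a)),
    hb.sigPos_eq_sigNeg (QuadraticMap.nondegenerate_polar_iff.1 (diagForm_nondegenerate b))]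
  ring

end WittRelations

/-! ### Reduction modulo a prime -/

section Reduction

/-- A rational subspace `W` of `ℚ^ι` can be reduced modulo `p` without loss of dimension: reduce the
vectors of the saturated lattice `W ∩ ℤ^ι`. -/
theorem exists_reduction_mod_prime (p : ℕ) [Fact p.Prime] {ι : Type*} [Fintype ι]
    (W : Submodule ℚ (ι → ℚ)) : ∃ W' : Submodule (ZMod p) (ι → ZMod p),
      finrank ℚ W ≤ finrank (ZMod p) W' ∧
      ∀ y ∈ W', ∃ x : ι → ℤ, (fun i => (x i : ℚ)) ∈ W ∧ (fun i => (x i : ZMod p)) = y := by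
  classical
  have hp0 : (p : ℤ) ≠ 0 := by exact_mod_cast (Fact.out : p.Prime).ne_zero
  let Λ : Submodule ℤ (ι → ℤ) :=
    (W.restrictScalars ℤ).comap ((Algebra.linearMap ℤ ℚ).compLeft ι)
  have hΛ : ∀ x : ι → ℤ, x ∈ Λ ↔ (fun i => (x i : ℚ)) ∈ W := fun x => Iff.rfl
  let W' : Submodule (ZMod p) (ι → ZMod p) :=
    { carrier := {y | ∃ x ∈ Λ, (fun i => (x i : ZMod p)) = y}
      zero_mem' := ⟨0, zero_mem _, by ext; simp⟩
      add_mem' := by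
        rintro _ _ ⟨x, hx, rfl⟩ ⟨y, hy, rfl⟩
        exact ⟨x + y, add_mem hx hy, by ext; simp⟩
      smul_mem' := by
        rintro c _ ⟨x, hx, rfl⟩
        refine ⟨(c.val : ℤ) • x, Λ.smul_mem _ hx, ?_⟩
        ext
        simp }
  refine ⟨W', ?_, fun y hy => hy⟩
  have h1 : finrank ℚ W ≤ finrank ℤ Λ := by
    let w := finBasis ℚ W
    have hN : ∃ N : ℤ, N ≠ 0 ∧ ∀ k i, ∃ z : ℤ, (z : ℚ) = N * (w k : ι → ℚ) i := by
      obtain ⟨N, hN⟩ := IsLocalization.exist_integer_multiples_of_finite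
        (nonZeroDivisors ℤ) (fun ki : Fin (finrank ℚ W) × ι => (w ki.1 : ι → ℚ) ki.2)
      refine ⟨N, nonZeroDivisors.ne_zero N.2, fun k i => ?_⟩
      obtain ⟨z, hz⟩ := hN (k, i)
      exact ⟨z, by simpa [Submonoid.smul_def] using hz⟩
    obtain ⟨N, hN0, hN⟩ := hN
    choose z hz using hN
    have hz' : ∀ k, (fun i => (z k i : ℚ)) = (N : ℚ) • (w k : ι → ℚ) := fun k => by
      ext i
      simp [hz]
    have hmem : ∀ k, z k ∈ Λ := fun k => by
      rw [hΛ, hz']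
      exact W.smul_mem _ (w k).2
    have hli : LinearIndependent ℤ (fun k => (⟨z k, hmem k⟩ : Λ)) := by
      rw [Fintype.linearIndependent_iff]
      intro c hc k
      have h2 : ∑ k, ((c k : ℚ) * N) • w k = 0 := by
        apply Subtype.ext
        funext i
        have h3 := congrFun (congrArg Subtype.val hc) i
        simp only [AddSubmonoidClass.coe_finsetSum, Finset.sum_apply, SetLike.val_smul,
          Pi.smul_apply, smul_eq_mul, ZeroMemClass.coe_zero, Pi.zero_apply] at h3 ⊢
        have h4 : ((∑ x, c x * z x i : ℤ) : ℚ) = 0 := by rw [h3]; simp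
        push_cast at h4
        rw [← h4]
        refine Finset.sum_congr rfl fun k _ => ?_
        rw [hz, mul_assoc]
      have h3 := Fintype.linearIndependent_iff.1 w.linearIndependent _ h2 k
      have hNQ : (N : ℚ) ≠ 0 := by exact_mod_cast hN0
      exact_mod_cast (mul_eq_zero.1 h3).resolve_right hNQ
    simpa using hli.fintype_card_le_finrank
  refine h1.trans ?_
  let b := finBasis ℤ Λ
  have hli : LinearIndependent (ZMod p)
      (fun k => (⟨fun i => ((b k : ι → ℤ) i : ZMod p), b k, (b k).2, rfl⟩ : W')) := by
    rw [Fintype.linearIndependent_iff]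
    intro c hc k
    -- lift the relation to `ℤ`: the combination is divisible by `p`, and so is each coefficient
    have h2 : ∀ i, (p : ℤ) ∣ ∑ k, ((c k).val : ℤ) * (b k : ι → ℤ) i := by
      intro i
      rw [← ZMod.intCast_zmod_eq_zero_iff_dvd]
      have h3 := congrFun (congrArg Subtype.val hc) i
      simp only [AddSubmonoidClass.coe_finsetSum, Finset.sum_apply, SetLike.val_smul,
        Pi.smul_apply, smul_eq_mul, ZeroMemClass.coe_zero, Pi.zero_apply] at h3
      push_cast
      simpa using h3
    choose x hx using h2
    have hpx : (p : ℤ) • x = ((∑ k, ((c k).val : ℤ) • b k : Λ) : ι → ℤ) := by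
      funext i
      simp only [Pi.smul_apply, smul_eq_mul, ← hx, AddSubmonoidClass.coe_finsetSum,
        Finset.sum_apply, SetLike.val_smul]
    have hxΛ : x ∈ Λ := by
      have h4 : (p : ℤ) • x ∈ Λ := hpx ▸ Subtype.prop _
      rw [hΛ] at h4 ⊢
      have h5 : (fun i => (x i : ℚ)) = (p : ℚ)⁻¹ • (fun i => ((((p : ℤ) • x) i : ℤ) : ℚ)) := by
        funext i
        have : (p : ℚ) ≠ 0 := by exact_mod_cast hp0
        simp [this]
      rw [h5]
      exact W.smul_mem _ h4
    have h6 : (p : ℤ) • (⟨x, hxΛ⟩ : Λ) = ∑ k, ((c k).val : ℤ) • b k := Subtype.ext hpx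
    have h7 := congrArg (fun v => b.repr v k) h6
    simp only [map_smul, map_sum, Basis.repr_self, Finsupp.coe_smul, Finsupp.coe_finsetSum,
      Pi.smul_apply, Finset.sum_apply, smul_eq_mul, Finsupp.single_apply, mul_ite, mul_one,
      mul_zero, Finset.sum_ite_eq', Finset.mem_univ, if_true] at h7
    have h8 : (((c k).val : ℤ) : ZMod p) = 0 := by
      rw [← h7]
      simp
    simpa using h8
  simpa using hli.fintype_card_le_finrank

/-- If an integral form `E ⊕ p D` has a rational Lagrangian, where `E` is nondegenerate modulo `p` and
the diagonal form `D` is anisotropic modulo `p`, then `D` has rank zero.  Otherwise the reduction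
modulo `p` of the Lagrangian is too large to inject into the reduction of `E`, which yields an
integral isotropic vector `(p x, y)` with `y` nonzero modulo `p`, and `D(y) ≡ 0`. -/
theorem isEmpty_of_anisotropic (p : ℕ) [Fact p.Prime] {ι δ : Type*} [Fintype ι] [DecidableEq ι]
    [Fintype δ] (E : Matrix ι ι ℤ) (hE : E.IsSymm) (hdet : (E.det : ZMod p) ≠ 0) (D : δ → ℤ)
    (hD : ∀ y : δ → ZMod p, ∑ k, (D k : ZMod p) * (y k * y k) = 0 → y = 0)
    (W : Submodule ℚ (ι ⊕ δ → ℚ))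
    (hW : ∀ x ∈ W, ∑ i, ∑ j, (E i j : ℚ) * x (.inl i) * x (.inl j)
      + ∑ k, (p * D k : ℚ) * (x (.inr k) * x (.inr k)) = 0)
    (hd : Fintype.card ι + Fintype.card δ ≤ 2 * finrank ℚ W) : IsEmpty δ := by
  classical
  obtain ⟨W', hWW', hlift⟩ := exists_reduction_mod_prime p W
  have hp0 : (p : ℤ) ≠ 0 := by exact_mod_cast (Fact.out : p.Prime).ne_zero
  -- the form on integral vectors
  let q : (ι ⊕ δ → ℤ) → ℤ := fun x => ∑ i, ∑ j, E i j * x (.inl i) * x (.inl j)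
      + ∑ k, (p * D k) * (x (.inr k) * x (.inr k))
  have hq : ∀ x : ι ⊕ δ → ℤ, (fun i => (x i : ℚ)) ∈ W → q x = 0 := by
    intro x hx
    have h := hW _ hx
    have h1 : ((q x : ℤ) : ℚ) = 0 := by
      rw [← h]
      simp [q]
    exact_mod_cast h1
  let B : LinearMap.BilinForm (ZMod p) (ι → ZMod p) := Matrix.toBilin' (E.map (Int.cast))
  have hBn : B.Nondegenerate := by
    refine LinearMap.BilinForm.nondegenerate_toBilin'_of_det_ne_zero' _ ?_
    have : (E.map (Int.cast : ℤ → ZMod p)).det = (E.det : ZMod p) :=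
      ((Int.castRingHom (ZMod p)).map_det E).symm
    rwa [this]
  have hsym : ∀ x y : ι → ℤ, ∑ i, ∑ j, E i j * x i * y j = ∑ i, ∑ j, E i j * y i * x j := by
    intro x y
    rw [Finset.sum_comm]
    refine Finset.sum_congr rfl fun i _ => Finset.sum_congr rfl fun j _ => ?_
    rw [hE.apply j i]
    ring
  let φ : W' →ₗ[ZMod p] (ι → ZMod p) := LinearMap.funLeft (ZMod p) (ZMod p) Sum.inl ∘ₗ W'.subtype
  have hiso : LinearMap.range φ ≤ B.orthogonal (LinearMap.range φ) := by
    rintro _ ⟨⟨y, hy⟩, rfl⟩ _ ⟨⟨y', hy'⟩, rfl⟩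
    obtain ⟨x, hx, rfl⟩ := hlift y hy
    obtain ⟨x', hx', rfl⟩ := hlift y' hy'
    have h3 : q (x' + x) = 0 := hq _ (by
      have := W.add_mem hx' hx
      convert this using 1
      ext
      simp)
    have h1 := hq x hx
    have h2 := hq x' hx'
    have h4 : ∑ i, ∑ j, E i j * x' (.inl i) * x (.inl j)
        + p * ∑ k, D k * (x' (.inr k) * x (.inr k)) = 0 := by
      have h5 : q (x' + x) = q x' + q x + (∑ i, ∑ j, E i j * x' (.inl i) * x (.inl j)
          + ∑ i, ∑ j, E i j * x (.inl i) * x' (.inl j)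
          + 2 * (p * ∑ k, D k * (x' (.inr k) * x (.inr k)))) := by
        have e1 : ∑ i, ∑ j, E i j * (x' + x) (.inl i) * (x' + x) (.inl j)
            = ∑ i, ∑ j, E i j * x' (.inl i) * x' (.inl j) + ∑ i, ∑ j, E i j * x (.inl i) * x (.inl j)
            + (∑ i, ∑ j, E i j * x' (.inl i) * x (.inl j)
            + ∑ i, ∑ j, E i j * x (.inl i) * x' (.inl j)) := by
          simp only [← Finset.sum_add_distrib]
          refine Finset.sum_congr rfl fun i _ => Finset.sum_congr rfl fun j _ => ?_
          rw [Pi.add_apply, Pi.add_apply]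
          ring
        have e2 : ∑ k, (p * D k) * ((x' + x) (.inr k) * (x' + x) (.inr k))
            = ∑ k, (p * D k) * (x' (.inr k) * x' (.inr k))
            + ∑ k, (p * D k) * (x (.inr k) * x (.inr k))
            + 2 * (p * ∑ k, D k * (x' (.inr k) * x (.inr k))) := by
          simp only [Finset.mul_sum, ← Finset.sum_add_distrib]
          refine Finset.sum_congr rfl fun k _ => ?_
          rw [Pi.add_apply]
          ring
        simp only [q, e1, e2]
        ring
      have h6 := hsym (fun i => x (.inl i)) (fun i => x' (.inl i))
      omega
    have h7 : ((∑ i, ∑ j, E i j * x' (.inl i) * x (.inl j) : ℤ) : ZMod p) = 0 := by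
      rw [ZMod.intCast_zmod_eq_zero_iff_dvd]
      exact ⟨-∑ k, D k * (x' (.inr k) * x (.inr k)), by linarith⟩
    change B _ _ = 0
    rw [← h7]
    simp [B, Matrix.toBilin'_apply, φ, LinearMap.funLeft]
    refine Finset.sum_congr rfl fun i _ => Finset.sum_congr rfl fun j _ => ?_
    ring
  have h1 := Submodule.finrank_mono hiso
  rw [LinearMap.BilinForm.finrank_orthogonal hBn] at h1
  have h2 := LinearMap.finrank_range_add_finrank_ker φ
  have h3 := Submodule.finrank_le (LinearMap.range φ)
  rw [finrank_fintype_fun_eq_card] at h1 h3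
  have h4 : LinearMap.ker φ = ⊥ := by
    rw [LinearMap.ker_eq_bot']
    rintro ⟨y, hy⟩ hφ
    obtain ⟨x, hx, rfl⟩ := hlift y hy
    have h5 : ∀ i, ∃ z : ℤ, x (.inl i) = p * z := by
      intro i
      have h6 := congrFun hφ i
      exact (ZMod.intCast_zmod_eq_zero_iff_dvd _ _).1 h6
    choose z hz using h5
    have h6 := hq x hx
    have h7 : (p : ℤ) * (p * ∑ i, ∑ j, E i j * z i * z j
        + ∑ k, D k * (x (.inr k) * x (.inr k))) = 0 := by
      rw [← h6]
      simp only [q, hz, mul_add, Finset.mul_sum]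
      congr 1
      · refine Finset.sum_congr rfl fun i _ => Finset.sum_congr rfl fun j _ => ?_
        ring
      · refine Finset.sum_congr rfl fun i _ => ?_
        ring
    have h8 : ((∑ k, D k * (x (.inr k) * x (.inr k)) : ℤ) : ZMod p) = 0 := by
      rw [ZMod.intCast_zmod_eq_zero_iff_dvd]
      exact ⟨-∑ i, ∑ j, E i j * z i * z j,
        by linarith [(mul_eq_zero.1 h7).resolve_left hp0]⟩
    have h9 := hD (fun k => (x (.inr k) : ZMod p)) (by simpa using h8)
    apply Subtype.ext
    funext i
    rcases i with i | k
    · exact congrFun hφ i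
    · exact congrFun h9 k
  rw [h4, finrank_bot] at h2
  rw [← Fintype.card_eq_zero_iff]
  omega

end Reduction

/-! ### Anisotropic representatives -/

section Symbols

variable {K G : Type*} [Field K] [AddCommGroup G] {f : Kˣ → G}

/-- If `f` satisfies the relations of the Witt group and the diagonal form `⟨a₀, …, aₙ⟩` represents
`z`, then `z` can be split off from its class. -/
theorem exists_sum_eq_add_of_represents (hsq : ∀ u c, f (u * c ^ 2) = f u)
    (hadd : ∀ u v w : Kˣ, (u : K) + v = w → f u + f v = f w + f (u * v * w)) :
    ∀ (n : ℕ) (a : Fin (n + 1) → Kˣ) (y : Fin (n + 1) → K) (z : Kˣ),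
      ∑ i, (a i : K) * (y i * y i) = z → ∃ b : Fin n → Kˣ, ∑ i, f (a i) = f z + ∑ i, f (b i) := by
  intro n
  induction n with
  | zero =>
    intro a y z h
    have hy : y 0 ≠ 0 := by
      rintro h0
      simp [h0] at h
      exact z.ne_zero h.symm
    refine ⟨Fin.elim0, ?_⟩
    have hz : z = a 0 * Units.mk0 _ hy ^ 2 := by
      ext
      rw [← h]
      simp [sq]
    simp [hz, hsq]
  | succ n ih =>
    intro a y z h
    rw [Fin.sum_univ_succ] at h
    simp_rw [Fin.sum_univ_succ (n := n + 1)]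
    by_cases hz₀ : ∑ i : Fin (n + 1), (a i.succ : K) * (y i.succ * y i.succ) = 0
    · rw [hz₀, add_zero] at h
      have hy : y 0 ≠ 0 := by
        rintro h0
        simp [h0] at h
        exact z.ne_zero h.symm
      have hz : z = a 0 * Units.mk0 _ hy ^ 2 := by
        ext
        rw [← h]
        simp [sq]
      exact ⟨fun i => a i.succ, by rw [hz, hsq, Fin.sum_univ_succ]⟩
    · obtain ⟨z₀, hz₀⟩ : ∃ z₀ : Kˣ,
          ∑ i : Fin (n + 1), (a i.succ : K) * (y i.succ * y i.succ) = z₀ := ⟨Units.mk0 _ hz₀, rfl⟩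
      rw [hz₀] at h
      obtain ⟨b, hb⟩ := ih (fun i => a i.succ) (fun i => y i.succ) z₀ hz₀
      by_cases hy : y 0 = 0
      · have hz : z = z₀ := by
          ext
          simpa [hy] using h.symm
        refine ⟨Fin.cons (a 0) b, ?_⟩
        rw [hb, Fin.sum_univ_succ]
        simp only [Fin.cons_zero, Fin.cons_succ, hz]
        abel
      · have h1 := hadd (a 0 * Units.mk0 _ hy ^ 2) z₀ z (by
          rw [← h]
          simp [sq])
        rw [hsq] at h1
        refine ⟨Fin.cons (a 0 * Units.mk0 _ hy ^ 2 * z₀ * z) b, ?_⟩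
        rw [hb, Fin.sum_univ_succ]
        simp only [Fin.cons_zero, Fin.cons_succ]
        rw [← add_assoc, h1]
        abel

/-- If `f` satisfies the relations of the Witt group, the class of an isotropic diagonal form is that
of a diagonal form of smaller rank. -/
theorem exists_shorter_of_isotropic (hsq : ∀ u c, f (u * c ^ 2) = f u) (hneg : ∀ u, f (-u) = -f u)
    (hadd : ∀ u v w : Kˣ, (u : K) + v = w → f u + f v = f w + f (u * v * w)) :
    ∀ (n : ℕ) (a : Fin n → Kˣ) (y : Fin n → K), y ≠ 0 → ∑ i, (a i : K) * (y i * y i) = 0 →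
      ∃ (m : ℕ) (b : Fin m → Kˣ), m < n ∧ ∑ i, f (a i) = ∑ i, f (b i) := by
  intro n
  induction n with
  | zero =>
    intro a y hy
    exact absurd (Subsingleton.elim y 0) hy
  | succ n ih =>
    intro a y hy h
    rw [Fin.sum_univ_succ] at h
    simp_rw [Fin.sum_univ_succ (n := n)]
    by_cases hy0 : y 0 = 0
    · obtain ⟨m, b, hm, hb⟩ := ih (fun i => a i.succ) (fun i => y i.succ) (by
        rintro h0
        apply hy
        ext i
        refine Fin.cases hy0 (fun j => congrFun h0 j) i) (by simpa [hy0] using h)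
      refine ⟨m + 1, Fin.cons (a 0) b, by omega, ?_⟩
      rw [hb, Fin.sum_univ_succ]
      simp
    · rcases n with _ | n
      · simp [hy0] at h
      · obtain ⟨b, hb⟩ := exists_sum_eq_add_of_represents hsq hadd n (fun i => a i.succ)
          (fun i => y i.succ) (-(a 0 * Units.mk0 _ hy0 ^ 2)) (by
            rw [eq_neg_of_add_eq_zero_right h]
            simp [sq])
        refine ⟨n, b, by omega, ?_⟩
        rw [hb, hneg, hsq]
        abel

/-- If `f` satisfies the relations of the Witt group, every class of a diagonal form is the class of an
anisotropic diagonal form. -/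
theorem exists_anisotropic_sum_eq (hsq : ∀ u c, f (u * c ^ 2) = f u) (hneg : ∀ u, f (-u) = -f u)
    (hadd : ∀ u v w : Kˣ, (u : K) + v = w → f u + f v = f w + f (u * v * w))
    (n : ℕ) (a : Fin n → Kˣ) : ∃ (m : ℕ) (b : Fin m → Kˣ),
      (∀ y : Fin m → K, ∑ i, (b i : K) * (y i * y i) = 0 → y = 0) ∧
      ∑ i, f (a i) = ∑ i, f (b i) := by
  induction n using Nat.strong_induction_on with
  | _ n ih =>
    by_cases h : ∀ y : Fin n → K, ∑ i, (a i : K) * (y i * y i) = 0 → y = 0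
    · exact ⟨n, a, h, rfl⟩
    · push Not at h
      obtain ⟨y, h0, hy⟩ := h
      obtain ⟨m, b, hm, hb⟩ := exists_shorter_of_isotropic hsq hneg hadd n a y hy h0
      obtain ⟨m', b', hb', hs⟩ := ih m hm b
      exact ⟨m', b', hb', hb.trans hs⟩

end Symbols

/-! ### The filtration of the Witt group by primes -/

section Filtration

/-- The rational numbers which are, up to sign, products of powers of integers between `1` and `k`;
equivalently, of primes at most `k`. -/
def smoothUnits (k : ℕ) : Subgroup ℚˣ :=
  Subgroup.closure {u | ∃ n : ℤ, n.natAbs ≤ k ∧ (u : ℚ) = n}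

/-- The preimage in the free abelian group on `ℚˣ` of the subgroup of `W(ℚ)` generated by the forms
`⟨u⟩`, where `u` is a product of primes at most `k`, up to sign. -/
noncomputable def wittFiltration (k : ℕ) : AddSubgroup (ℚˣ →₀ ℤ) :=
  wittRelations ⊔ AddSubgroup.closure ((fun u => Finsupp.single u 1) '' smoothUnits k)

theorem wittRelations_le_wittFiltration (k : ℕ) : wittRelations ≤ wittFiltration k := le_sup_left

theorem mem_smoothUnits_of_eq {k : ℕ} {u : ℚˣ} {n : ℤ} (hn : n.natAbs ≤ k) (hu : (u : ℚ) = n) :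
    u ∈ smoothUnits k :=
  Subgroup.subset_closure ⟨n, hn, hu⟩

theorem neg_mem_smoothUnits {k : ℕ} (hk : 1 ≤ k) {u : ℚˣ} (hu : u ∈ smoothUnits k) :
    -u ∈ smoothUnits k := by
  rw [← neg_one_mul]
  exact mul_mem (mem_smoothUnits_of_eq (n := -1) (by simpa using hk) (by simp)) hu

theorem smoothUnits_succ_of_not_prime {k : ℕ} (hk : 1 ≤ k) (hp : ¬ (k + 1).Prime) :
    smoothUnits (k + 1) ≤ smoothUnits k := by
  rw [smoothUnits, Subgroup.closure_le]
  rintro u ⟨n, hn, hu⟩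
  by_cases hnk : n.natAbs ≤ k
  · exact mem_smoothUnits_of_eq hnk hu
  obtain ⟨a, b, ha, hb, hab⟩ := (Nat.not_prime_iff_exists_mul_eq (by omega)).1 hp
  have ha0 : (a : ℚ) ≠ 0 := by
    rintro h
    rw [Nat.cast_eq_zero] at h
    simp [h] at hab
  have hb0 : (b : ℚ) ≠ 0 := by
    rintro h
    rw [Nat.cast_eq_zero] at h
    simp [h] at hab
  have h1 : Units.mk0 _ ha0 * Units.mk0 _ hb0 ∈ smoothUnits k :=
    mul_mem (mem_smoothUnits_of_eq (n := a) (by simpa using Nat.lt_succ_iff.1 ha) (by simp))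
      (mem_smoothUnits_of_eq (n := b) (by simpa using Nat.lt_succ_iff.1 hb) (by simp))
  have h2 : (n : ℤ) = a * b ∨ (n : ℤ) = -(a * b : ℤ) := by
    have : ((a * b : ℕ) : ℤ) = n.natAbs := by omega
    push_cast at this
    omega
  rcases h2 with h2 | h2
  · have h3 : u = Units.mk0 _ ha0 * Units.mk0 _ hb0 := by
      ext
      rw [hu, h2]
      simp
    exact h3 ▸ h1
  · have h3 : u = -(Units.mk0 _ ha0 * Units.mk0 _ hb0) := by
      ext
      rw [hu, h2]
      simp
    exact h3 ▸ neg_mem_smoothUnits hk h1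

theorem wittFiltration_succ_of_not_prime {k : ℕ} (hk : 1 ≤ k) (hp : ¬ (k + 1).Prime) :
    wittFiltration (k + 1) ≤ wittFiltration k :=
  sup_le_sup_left (AddSubgroup.closure_mono
    (Set.image_mono (smoothUnits_succ_of_not_prime hk hp))) _

theorem exists_diagClass_mem_wittFiltration {ι : Type*} [Fintype ι] (a : ι → ℚˣ) :
    ∃ k, 1 ≤ k ∧ diagClass a ∈ wittFiltration k := by
  let h : ι → ℕ := fun i => (a i : ℚ).num.natAbs + (a i : ℚ).den
  refine ⟨1 + ∑ i, h i, by omega, sum_mem fun i _ => ?_⟩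
  refine (le_sup_right : _ ≤ wittFiltration _) (AddSubgroup.subset_closure ⟨a i, ?_, rfl⟩)
  have hi : h i ≤ ∑ i, h i := Finset.single_le_sum (fun _ _ => Nat.zero_le _) (Finset.mem_univ i)
  have hn : ((a i : ℚ).num : ℚ) ≠ 0 := by simp
  have hd : ((a i : ℚ).den : ℚ) ≠ 0 := by simp
  have h1 : a i = Units.mk0 _ hn * (Units.mk0 _ hd)⁻¹ := by
    ext
    simp [← div_eq_mul_inv, Rat.num_div_den]
  rw [h1]
  refine mul_mem (mem_smoothUnits_of_eq (n := (a i : ℚ).num) ?_ (by simp))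
    (inv_mem (mem_smoothUnits_of_eq (n := (a i : ℚ).den) ?_ (by simp)))
  · simp only [h] at hi ⊢
    omega
  · simp only [h, Int.natAbs_natCast] at hi ⊢
    omega

theorem exists_sum_eq_of_mem_closure {α G : Type*} [AddCommGroup G] (f : α → G) (s : Set α)
    (hneg : ∀ u ∈ s, ∃ v ∈ s, f v = -f u) {x : G} (hx : x ∈ AddSubgroup.closure (f '' s)) :
    ∃ (n : ℕ) (a : Fin n → α), (∀ i, a i ∈ s) ∧ ∑ i, f (a i) = x := by
  induction hx using AddSubgroup.closure_induction with
  | mem x hx =>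
    obtain ⟨u, hu, rfl⟩ := hx
    exact ⟨1, fun _ => u, fun _ => hu, by simp⟩
  | zero => exact ⟨0, Fin.elim0, fun i => i.elim0, by simp⟩
  | add x y _ _ hx hy =>
    obtain ⟨n, a, ha, rfl⟩ := hx
    obtain ⟨m, b, hb, rfl⟩ := hy
    refine ⟨n + m, Fin.append a b, fun i => ?_, by simp [Fin.sum_univ_add]⟩
    refine Fin.addCases (fun j => ?_) (fun j => ?_) i
    · simpa using ha j
    · simpa using hb j
  | neg x _ hx =>
    obtain ⟨n, a, ha, rfl⟩ := hx
    choose b hb hab using fun i => hneg _ (ha i)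
    exact ⟨n, b, hb, by simp [hab]⟩

theorem exists_diagClass_sub_mem {k : ℕ} (hk : 1 ≤ k) {x : ℚˣ →₀ ℤ} (hx : x ∈ wittFiltration k) :
    ∃ (n : ℕ) (a : Fin n → ℚˣ), (∀ i, a i ∈ smoothUnits k) ∧ x - diagClass a ∈ wittRelations := by
  obtain ⟨y, hy, z, hz, rfl⟩ := AddSubgroup.mem_sup.1 hx
  have h1 : QuotientAddGroup.mk' wittRelations z ∈ AddSubgroup.closure
      ((fun u : ℚˣ => QuotientAddGroup.mk' wittRelations (Finsupp.single u 1)) ''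
        smoothUnits k) := by
    have h2 := AddSubgroup.mem_map_of_mem (QuotientAddGroup.mk' wittRelations) hz
    rwa [AddMonoidHom.map_closure, Set.image_image] at h2
  obtain ⟨n, a, ha, hs⟩ := exists_sum_eq_of_mem_closure _ _ (fun u hu =>
    ⟨-u, neg_mem_smoothUnits hk hu, by
      rw [eq_neg_iff_add_eq_zero, add_comm, ← map_add]
      exact (QuotientAddGroup.eq_zero_iff _).2 (single_add_single_neg_mem u)⟩) h1
  refine ⟨n, a, ha, ?_⟩
  rw [← map_sum] at hs
  have h3 := QuotientAddGroup.eq.1 hs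
  have h4 := add_mem hy h3
  convert h4 using 1
  simp only [diagClass]
  abel

/-- The class of `⟨u⟩` modulo a subgroup of the free abelian group on `ℚˣ`. -/
noncomputable def symbolMod (L : AddSubgroup (ℚˣ →₀ ℤ)) (u : ℚˣ) : (ℚˣ →₀ ℤ) ⧸ L :=
  QuotientAddGroup.mk' L (Finsupp.single u 1)

section SymbolMod

variable {L : AddSubgroup (ℚˣ →₀ ℤ)}

theorem symbolMod_mul_sq (hL : wittRelations ≤ L) (u c : ℚˣ) :
    symbolMod L (u * c ^ 2) = symbolMod L u := by
  rw [← sub_eq_zero, symbolMod, symbolMod, ← map_sub]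
  exact (QuotientAddGroup.eq_zero_iff _).2 (hL (single_mul_sq_sub_mem u c))

theorem symbolMod_neg (hL : wittRelations ≤ L) (u : ℚˣ) : symbolMod L (-u) = -symbolMod L u := by
  rw [eq_neg_iff_add_eq_zero, add_comm, symbolMod, symbolMod, ← map_add]
  exact (QuotientAddGroup.eq_zero_iff _).2 (hL (single_add_single_neg_mem u))

theorem symbolMod_add (hL : wittRelations ≤ L) {a b c : ℚˣ} (h : (a : ℚ) + b = c) :
    symbolMod L a + symbolMod L b = symbolMod L c + symbolMod L (a * b * c) := by
  rw [← sub_eq_zero]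
  simp only [symbolMod, ← map_add, ← map_sub]
  exact (QuotientAddGroup.eq_zero_iff _).2 (hL (single_add_single_sub_mem a b c h))

theorem symbolMod_eq_zero {k : ℕ} {u : ℚˣ} (hu : u ∈ smoothUnits k) :
    symbolMod (wittFiltration k) u = 0 :=
  (QuotientAddGroup.eq_zero_iff _).2
    ((le_sup_right : _ ≤ wittFiltration _) (AddSubgroup.subset_closure ⟨u, hu, rfl⟩))

end SymbolMod

end Filtration

/-! ### Residues modulo a prime -/

section PrimeStep

variable (p : ℕ) [hp : Fact p.Prime]

/-- The prime `p` as a rational unit. -/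
def primeUnit : ℚˣ := Units.mk0 p (by exact_mod_cast hp.out.ne_zero)

/-- The representative of a unit modulo `p` between `1` and `p - 1`, as a rational unit. -/
def residueRep (c : (ZMod p)ˣ) : ℚˣ :=
  Units.mk0 ((c : ZMod p).val : ℚ) (by
    rw [Nat.cast_ne_zero, Ne, ZMod.val_eq_zero]
    exact c.ne_zero)

/-- The class of `⟨p u⟩` modulo the forms whose coefficients only involve primes smaller than `p`. -/
noncomputable def primeSymbol (u : ℚˣ) : (ℚˣ →₀ ℤ) ⧸ wittFiltration (p - 1) :=
  symbolMod (wittFiltration (p - 1)) (primeUnit p * u)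

variable {p}

theorem coe_residueRep (c : (ZMod p)ˣ) : (residueRep p c : ℚ) = ((c : ZMod p).val : ℤ) := rfl

theorem residueRep_mem (c : (ZMod p)ˣ) : residueRep p c ∈ smoothUnits (p - 1) :=
  mem_smoothUnits_of_eq (by
    have := ZMod.val_lt (c : ZMod p)
    rw [Int.natAbs_natCast]
    omega) (coe_residueRep c)

theorem primeSymbol_mul_sq (u c : ℚˣ) :
    primeSymbol p (u * c ^ 2) = primeSymbol p u := by
  rw [primeSymbol, ← mul_assoc, symbolMod_mul_sq (wittRelations_le_wittFiltration _), primeSymbol]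

theorem primeSymbol_neg (u : ℚˣ) : primeSymbol p (-u) = -primeSymbol p u := by
  rw [primeSymbol, mul_neg, symbolMod_neg (wittRelations_le_wittFiltration _), primeSymbol]

/-- Division with remainder: if `N = r + p l`, then `⟨p w r⟩ + ⟨w l⟩ = ⟨p w N⟩ + ⟨w r l N⟩`, as squares
can be dropped. -/
theorem primeSymbol_congr {w N r l : ℚˣ} (hw : w ∈ smoothUnits (p - 1))
    (hN : N ∈ smoothUnits (p - 1)) (hr : r ∈ smoothUnits (p - 1)) (hl : l ∈ smoothUnits (p - 1))
    (h : (N : ℚ) = r + p * l) : primeSymbol p (w * N) = primeSymbol p (w * r) := by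
  have h1 := symbolMod_add (wittRelations_le_wittFiltration (p - 1))
    (a := primeUnit p * (w * r)) (b := (w * l) * primeUnit p ^ 2) (c := primeUnit p * (w * N)) (by
      simp [h, primeUnit]
      ring)
  have h2 : primeUnit p * (w * r) * ((w * l) * primeUnit p ^ 2) * (primeUnit p * (w * N))
      = (w * r * l * N) * (primeUnit p ^ 2 * w) ^ 2 := by
    ext
    push_cast
    ring
  rw [h2, symbolMod_mul_sq (wittRelations_le_wittFiltration _), symbolMod_mul_sq (wittRelations_le_wittFiltration _),
    symbolMod_eq_zero (mul_mem hw hl),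
    symbolMod_eq_zero (mul_mem (mul_mem (mul_mem hw hr) hl) hN), add_zero, add_zero] at h1
  exact h1.symm

/-- The class of `⟨p w N⟩` only depends on the residue of `N` modulo `p`, for small `N`. -/
theorem primeSymbol_eq_of_intCast_eq {w N : ℚˣ} {z : ℤ} {c : (ZMod p)ˣ}
    (hw : w ∈ smoothUnits (p - 1)) (hN : N ∈ smoothUnits (p - 1)) (hNz : (N : ℚ) = z)
    (hz : z.natAbs ≤ (p - 1) * (p - 1)) (hc : (z : ZMod p) = c) :
    primeSymbol p (w * N) = primeSymbol p (w * residueRep p c) := by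
  have hp2 := hp.out.two_le
  have hmod : ((c : ZMod p).val : ℤ) = z % p := by rw [← hc, ZMod.val_intCast]
  have hdiv := Int.emod_add_mul_ediv z p
  by_cases hl : z / p = 0
  · have : N = residueRep p c := by
      ext
      rw [hNz, coe_residueRep, hmod]
      rw [hl, mul_zero, add_zero] at hdiv
      rw [hdiv]
    rw [this]
  · have hl' : ((z / p : ℤ) : ℚ) ≠ 0 := by exact_mod_cast hl
    refine primeSymbol_congr hw hN (residueRep_mem c) (l := Units.mk0 _ hl')
      (mem_smoothUnits_of_eq (n := z / p) ?_ rfl) ?_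
    · obtain ⟨q, rfl⟩ : ∃ q, p = q + 1 := ⟨p - 1, by omega⟩
      rw [Nat.add_sub_cancel] at hz ⊢
      have h1 : (z.natAbs : ℤ) ≤ q * q := by exact_mod_cast hz
      have h2 : z < (q + 1) * (q + 1) := by nlinarith [Int.le_natAbs (a := z)]
      have h3 : -((q + 1) * (q + 1)) < z := by
        have := Int.le_natAbs (a := -z)
        rw [Int.natAbs_neg] at this
        nlinarith
      have h4 : z / ((q + 1 : ℕ) : ℤ) < q + 1 := by
        apply Int.ediv_lt_of_lt_mul (by positivity)
        push_cast
        linarith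
      have h5 : -(q + 1 : ℤ) ≤ z / ((q + 1 : ℕ) : ℤ) := by
        apply Int.le_ediv_of_mul_le (by positivity)
        push_cast
        linarith
      have h6 : z / ((q + 1 : ℕ) : ℤ) ≠ -(q + 1 : ℤ) := by
        intro h
        have h7 := Int.emod_lt_of_pos z (b := ((q + 1 : ℕ) : ℤ)) (by positivity)
        rw [h] at hdiv
        have h8 : -((q : ℤ) * q) ≤ z := by
          have := Int.le_natAbs (a := -z)
          rw [Int.natAbs_neg] at this
          linarith
        push_cast at hdiv h7
        nlinarith
      omega
    · rw [hNz, coe_residueRep, hmod]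
      simp only [Units.val_mk0]
      exact_mod_cast hdiv.symm

theorem primeSymbol_residueRep_mul_sq (c d : (ZMod p)ˣ) :
    primeSymbol p (residueRep p (c * d ^ 2)) = primeSymbol p (residueRep p c) := by
  have hval : ∀ e : (ZMod p)ˣ, (e : ZMod p).val ≤ p - 1 := fun e => by
    have := ZMod.val_lt (e : ZMod p)
    omega
  have key : ∀ (w : ℚˣ) (c d : (ZMod p)ˣ), w ∈ smoothUnits (p - 1) →
      primeSymbol p (w * (residueRep p c * residueRep p d))
        = primeSymbol p (w * residueRep p (c * d)) := by
    intro w c d hw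
    refine primeSymbol_eq_of_intCast_eq hw (mul_mem (residueRep_mem c) (residueRep_mem d))
      (z := (c : ZMod p).val * (d : ZMod p).val) ?_ ?_ ?_
    · simp [coe_residueRep]
    · rw [Int.natAbs_mul, Int.natAbs_natCast, Int.natAbs_natCast]
      exact Nat.mul_le_mul (hval c) (hval d)
    · simp
  calc primeSymbol p (residueRep p (c * d ^ 2))
      = primeSymbol p (1 * residueRep p (d * (c * d))) := by
        rw [one_mul]
        congr 2
        rw [sq, mul_left_comm]
    _ = primeSymbol p (residueRep p d * residueRep p (c * d)) := by
        rw [← key 1 d (c * d) (one_mem _), one_mul]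
    _ = primeSymbol p (residueRep p c * residueRep p d ^ 2) := by
        rw [← key _ c d (residueRep_mem d), sq, mul_left_comm]
    _ = primeSymbol p (residueRep p c) := primeSymbol_mul_sq _ _

theorem primeSymbol_eq_residueRep {u : ℚˣ} {z : ℤ} {c : (ZMod p)ˣ} (hu : (u : ℚ) = z)
    (hz : z.natAbs ≤ p - 1) (hc : (z : ZMod p) = c) :
    primeSymbol p u = primeSymbol p (residueRep p c) := by
  have h := primeSymbol_eq_of_intCast_eq (w := 1) (one_mem _) (mem_smoothUnits_of_eq hz hu) hu
    (hz.trans (Nat.le_mul_self _)) hc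
  rwa [one_mul, one_mul] at h

theorem primeSymbol_residueRep_neg (c : (ZMod p)ˣ) :
    primeSymbol p (residueRep p (-c)) = -primeSymbol p (residueRep p c) := by
  have := ZMod.val_lt (c : ZMod p)
  rw [← primeSymbol_neg]
  refine (primeSymbol_eq_residueRep (z := -((c : ZMod p).val : ℤ)) ?_ ?_ ?_).symm
  · rw [Units.val_neg, coe_residueRep]
    simp
  · rw [Int.natAbs_neg, Int.natAbs_natCast]
    omega
  · simp

theorem primeSymbol_residueRep_add {u v w : (ZMod p)ˣ} (h : (u : ZMod p) + v = w) :
    primeSymbol p (residueRep p u) + primeSymbol p (residueRep p v)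
      = primeSymbol p (residueRep p w) + primeSymbol p (residueRep p (u * v * w)) := by
  have hu := ZMod.val_lt (u : ZMod p)
  have hv := ZMod.val_lt (v : ZMod p)
  have hw := ZMod.val_lt (w : ZMod p)
  have hu0 : (u : ZMod p).val ≠ 0 := by
    rw [Ne, ZMod.val_eq_zero]
    exact u.ne_zero
  -- replace the representative of `u` by `z`, so that the sum is small
  obtain ⟨z, hz, hzu, hzw⟩ : ∃ z : ℤ, z.natAbs ≤ p - 1 ∧ (z : ZMod p) = u ∧
      z + (v : ZMod p).val = (w : ZMod p).val := by
    have hsum := ZMod.val_add (u : ZMod p) v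
    rw [h] at hsum
    by_cases hlt : (u : ZMod p).val + (v : ZMod p).val < p
    · rw [Nat.mod_eq_of_lt hlt] at hsum
      exact ⟨(u : ZMod p).val, by rw [Int.natAbs_natCast]; omega, by simp, by omega⟩
    · rw [Nat.mod_eq_sub_mod (by omega), Nat.mod_eq_of_lt (by omega)] at hsum
      exact ⟨(u : ZMod p).val - p, by omega, by simp, by omega⟩
  have hz0 : (z : ℚ) ≠ 0 := by
    rintro h0
    rw [Int.cast_eq_zero] at h0
    rw [h0, Int.cast_zero] at hzu
    exact u.ne_zero hzu.symm
  have hzmem : Units.mk0 (z : ℚ) hz0 ∈ smoothUnits (p - 1) := mem_smoothUnits_of_eq hz rfl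
  rw [← primeSymbol_eq_residueRep (u := Units.mk0 (z : ℚ) hz0) rfl hz hzu]
  have h1 := symbolMod_add (wittRelations_le_wittFiltration (p - 1))
    (a := primeUnit p * Units.mk0 (z : ℚ) hz0) (b := primeUnit p * residueRep p v)
    (c := primeUnit p * residueRep p w) (by
      have : (z : ℚ) + ((v : ZMod p).val : ℤ) = ((w : ZMod p).val : ℤ) := by exact_mod_cast hzw
      rw [Units.val_mul, Units.val_mul, Units.val_mul, coe_residueRep, coe_residueRep, ← this,
        Units.val_mk0, mul_add])
  have h2 : primeUnit p * Units.mk0 (z : ℚ) hz0 * (primeUnit p * residueRep p v)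
        * (primeUnit p * residueRep p w)
      = primeUnit p * (residueRep p w * (Units.mk0 (z : ℚ) hz0 * residueRep p v))
        * primeUnit p ^ 2 := by
    ext
    push_cast
    ring
  rw [h2, symbolMod_mul_sq (wittRelations_le_wittFiltration _)] at h1
  refine h1.trans (congrArg₂ (· + ·) rfl ?_)
  have h3 := primeSymbol_eq_of_intCast_eq (residueRep_mem w)
    (mul_mem hzmem (residueRep_mem v)) (z := z * (v : ZMod p).val) (c := u * v)
    (by simp [coe_residueRep]) (by
      rw [Int.natAbs_mul, Int.natAbs_natCast]
      exact Nat.mul_le_mul hz (by omega)) (by simp [hzu])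
  have h4 := primeSymbol_eq_of_intCast_eq (one_mem (smoothUnits (p - 1)))
    (mul_mem (residueRep_mem w) (residueRep_mem (u * v)))
    (z := (w : ZMod p).val * ((u * v : (ZMod p)ˣ) : ZMod p).val) (c := u * v * w)
    (by simp [coe_residueRep]) (by
      rw [Int.natAbs_mul, Int.natAbs_natCast, Int.natAbs_natCast]
      have := ZMod.val_lt ((u * v : (ZMod p)ˣ) : ZMod p)
      exact Nat.mul_le_mul (by omega) (by omega)) (by simp [mul_comm])
  rw [one_mul, one_mul] at h4
  exact h3.trans h4

/-- Every class `⟨p u⟩`, where the primes in `u` are smaller than `p`, is that of some `⟨p r⟩` with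
`0 < r < p`. -/
theorem exists_primeSymbol_eq_residueRep {u : ℚˣ} (hu : u ∈ smoothUnits (p - 1)) :
    ∃ c, primeSymbol p u = primeSymbol p (residueRep p c) := by
  have hp2 := hp.out.two_le
  suffices ∃ c, ∀ w ∈ smoothUnits (p - 1),
      primeSymbol p (w * u) = primeSymbol p (w * residueRep p c) by
    obtain ⟨c, hc⟩ := this
    exact ⟨c, by simpa using hc 1 (one_mem _)⟩
  have hu' := hu
  rw [smoothUnits] at hu
  induction hu using Subgroup.closure_induction with
  | mem u h =>
    obtain ⟨n, hn, hun⟩ := h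
    have hn0 : n ≠ 0 := by
      rintro rfl
      simp at hun
    have hnp : (n : ZMod p) ≠ 0 := by
      rw [Ne, ZMod.intCast_zmod_eq_zero_iff_dvd, Int.natCast_dvd]
      intro hd
      have := Nat.le_of_dvd (by omega) hd
      omega
    exact ⟨Units.mk0 _ hnp, fun w hw => primeSymbol_eq_of_intCast_eq hw hu' hun
      (hn.trans (Nat.le_mul_self _)) rfl⟩
  | one =>
    have : Fact (1 < p) := ⟨hp.out.one_lt⟩
    refine ⟨1, fun w _ => ?_⟩
    congr 2
    ext
    simp [coe_residueRep, ZMod.val_one]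
  | mul x y hx hy ihx ihy =>
    obtain ⟨c, hc⟩ := ihx hx
    obtain ⟨d, hd⟩ := ihy hy
    refine ⟨c * d, fun w hw => ?_⟩
    rw [mul_comm x, ← mul_assoc, hc _ (mul_mem hw hy), mul_right_comm,
      hd _ (mul_mem hw (residueRep_mem c)), mul_assoc]
    refine primeSymbol_eq_of_intCast_eq hw (mul_mem (residueRep_mem c) (residueRep_mem d))
      (z := (c : ZMod p).val * (d : ZMod p).val) (by simp [coe_residueRep]) ?_ (by simp)
    have h1 := ZMod.val_lt (c : ZMod p)
    have h2 := ZMod.val_lt (d : ZMod p)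
    rw [Int.natAbs_mul, Int.natAbs_natCast, Int.natAbs_natCast]
    exact Nat.mul_le_mul (by omega) (by omega)
  | inv x hx ihx =>
    obtain ⟨c, hc⟩ := ihx hx
    refine ⟨c, fun w hw => ?_⟩
    rw [← hc w hw, ← primeSymbol_mul_sq (w * x⁻¹) x]
    congr 1
    rw [sq, mul_assoc, inv_mul_cancel_left]

/-- Modulo forms whose coefficients only involve primes smaller than `p`, every form whose
coefficients only involve primes up to `p` is Witt equivalent to `p D`, where `D` is a diagonal form
which is anisotropic modulo `p`. -/
theorem exists_anisotropic_residue {x : ℚˣ →₀ ℤ} (hx : x ∈ wittFiltration p) :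
    ∃ (m : ℕ) (c : Fin m → (ZMod p)ˣ),
      (∀ y : Fin m → ZMod p, ∑ i, (c i : ZMod p) * (y i * y i) = 0 → y = 0) ∧
      x - diagClass (fun i => primeUnit p * residueRep p (c i)) ∈ wittFiltration (p - 1) := by
  have hp2 := hp.out.two_le
  let f : (ZMod p)ˣ → (ℚˣ →₀ ℤ) ⧸ wittFiltration (p - 1) := fun c => primeSymbol p (residueRep p c)
  have hle : wittFiltration p ≤ (AddSubgroup.closure (f '' Set.univ)).comap
      (QuotientAddGroup.mk' (wittFiltration (p - 1))) := by
    refine sup_le ?_ ((AddSubgroup.closure_le _).2 ?_)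
    · intro y hy
      have : QuotientAddGroup.mk' (wittFiltration (p - 1)) y = 0 :=
        (QuotientAddGroup.eq_zero_iff _).2 (wittRelations_le_wittFiltration _ hy)
      rw [AddSubgroup.mem_comap, this]
      exact zero_mem _
    · rintro _ ⟨u, hu, rfl⟩
      change symbolMod (wittFiltration (p - 1)) u ∈ AddSubgroup.closure (f '' Set.univ)
      have h1 : smoothUnits p ≤ smoothUnits (p - 1) ⊔ Subgroup.zpowers (primeUnit p) := by
        rw [smoothUnits, Subgroup.closure_le]
        rintro u ⟨n, hn, hun⟩
        by_cases hnp : n.natAbs ≤ p - 1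
        · exact Subgroup.mem_sup_left (mem_smoothUnits_of_eq hnp hun)
        · have h2 : n = p ∨ n = -p := by omega
          rcases h2 with rfl | rfl
          · refine Subgroup.mem_sup_right ?_
            convert Subgroup.mem_zpowers (primeUnit p)
            ext
            simpa [primeUnit] using hun
          · have h3 : u = -1 * primeUnit p := by
              ext
              simpa [primeUnit] using hun
            rw [h3]
            exact mul_mem (Subgroup.mem_sup_left (mem_smoothUnits_of_eq (n := -1)
              (by simp; omega) (by simp))) (Subgroup.mem_sup_right (Subgroup.mem_zpowers _))
      obtain ⟨v, hv, _, ⟨e, rfl⟩, rfl⟩ := Subgroup.mem_sup.1 (h1 hu)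
      rcases Int.even_or_odd' e with ⟨k, rfl | rfl⟩
      · have h2 : v * (primeUnit p) ^ (2 * k) = v * (primeUnit p ^ k) ^ 2 := by
          rw [mul_comm 2 k, zpow_mul]
          rfl
        simp only [h2]
        rw [symbolMod_mul_sq (wittRelations_le_wittFiltration _), symbolMod_eq_zero hv]
        exact zero_mem _
      · have h2 : v * (primeUnit p) ^ (2 * k + 1) = primeUnit p * v * (primeUnit p ^ k) ^ 2 := by
          rw [zpow_add, mul_comm 2 k, zpow_mul, zpow_one, mul_comm (primeUnit p) v, mul_assoc,
            mul_comm (primeUnit p)]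
          rfl
        simp only [h2]
        rw [symbolMod_mul_sq (wittRelations_le_wittFiltration _)]
        obtain ⟨c, hc⟩ := exists_primeSymbol_eq_residueRep hv
        exact AddSubgroup.subset_closure ⟨c, trivial, hc.symm⟩
  obtain ⟨n, a, -, ha⟩ := exists_sum_eq_of_mem_closure f Set.univ
    (fun c _ => ⟨-c, trivial, primeSymbol_residueRep_neg c⟩) (hle hx)
  obtain ⟨m, c, hc, hs⟩ := exists_anisotropic_sum_eq (f := f) primeSymbol_residueRep_mul_sq
    primeSymbol_residueRep_neg (fun u v w h => primeSymbol_residueRep_add h) n a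
  refine ⟨m, c, hc, ?_⟩
  rw [← QuotientAddGroup.eq_zero_iff]
  change QuotientAddGroup.mk' (wittFiltration (p - 1)) _ = 0
  rw [map_sub, ← ha, hs, sub_eq_zero, diagClass, map_sum]
  rfl

end PrimeStep

/-! ### Unimodular forms of signature zero -/

section Unimodular

theorem exists_integer_mul_sq {p : ℕ} (hp : p.Prime) {u : ℚˣ} (hu : u ∈ smoothUnits (p - 1)) :
    ∃ (c : ℚˣ) (n : ℤ), ¬ (p : ℤ) ∣ n ∧ ((u * c ^ 2 : ℚˣ) : ℚ) = n := by
  have hp2 := hp.two_le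
  rw [smoothUnits] at hu
  induction hu using Subgroup.closure_induction with
  | mem u h =>
    obtain ⟨n, hn, hun⟩ := h
    refine ⟨1, n, ?_, by simpa using hun⟩
    have hn0 : n ≠ 0 := by
      rintro rfl
      simp at hun
    rw [Int.natCast_dvd]
    intro hd
    have := Nat.le_of_dvd (by omega) hd
    omega
  | one => exact ⟨1, 1, by rw [Int.natCast_dvd]; simpa using hp.ne_one, by simp⟩
  | mul x y _ _ hx hy =>
    obtain ⟨c, n, hn, h⟩ := hx
    obtain ⟨c', n', hn', h'⟩ := hy
    refine ⟨c * c', n * n', ?_, ?_⟩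
    · intro hd
      rcases (Nat.prime_iff_prime_int.1 hp).dvd_or_dvd hd with h | h
      · exact hn h
      · exact hn' h
    · rw [Int.cast_mul, ← h, ← h']
      push_cast
      ring
  | inv x _ hx =>
    obtain ⟨c, n, hn, h⟩ := hx
    refine ⟨x * c, n, hn, ?_⟩
    rw [← h]
    push_cast
    field_simp

theorem exists_integral_diagClass_sub_mem {p : ℕ} (hp : p.Prime) (hp1 : 1 ≤ p - 1)
    {x : ℚˣ →₀ ℤ} (hx : x ∈ wittFiltration (p - 1)) :
    ∃ (n : ℕ) (d : Fin n → ℚˣ) (D : Fin n → ℤ), (∀ i, (d i : ℚ) = D i) ∧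
      (∀ i, ¬ (p : ℤ) ∣ D i) ∧ x - diagClass d ∈ wittRelations := by
  obtain ⟨n, a, ha, hxa⟩ := exists_diagClass_sub_mem hp1 hx
  choose c D hD hcD using fun i => exists_integer_mul_sq hp (ha i)
  refine ⟨n, fun i => a i * c i ^ 2, D, hcD, hD, ?_⟩
  have h : diagClass (fun i => a i * c i ^ 2) - diagClass a ∈ wittRelations := by
    rw [diagClass, diagClass, ← Finset.sum_sub_distrib]
    exact sum_mem fun i _ => single_mul_sq_sub_mem _ _
  convert sub_mem hxa h using 1
  abel

theorem diagClass_add_diagClass_neg_mem {ι : Type*} [Fintype ι] (a : ι → ℚˣ) :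
    diagClass a + diagClass (fun i => -a i) ∈ wittRelations := by
  rw [diagClass, diagClass, ← Finset.sum_add_distrib]
  exact sum_mem fun i _ => single_add_single_neg_mem _

variable {κ ι : Type*} [Fintype κ] [DecidableEq κ] [Fintype ι]

/-- The rational quadratic form with an integral Gram matrix. -/
noncomputable def gramForm (G : Matrix κ κ ℤ) : QuadraticForm ℚ (κ → ℚ) :=
  (Matrix.toBilin' (G.map (Int.cast : ℤ → ℚ))).toQuadraticMap

theorem gramForm_apply (G : Matrix κ κ ℤ) (x : κ → ℚ) :
    gramForm G x = ∑ i, ∑ j, (G i j : ℚ) * x i * x j := by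
  rw [gramForm, LinearMap.BilinMap.toQuadraticMap_apply, Matrix.toBilin'_apply]
  refine Finset.sum_congr rfl fun i _ => Finset.sum_congr rfl fun j _ => ?_
  rw [Matrix.map_apply]
  ring

/-- The prime `p` does not occur in the Witt class of a unimodular form: otherwise this class is
`D' ⊕ p D` with `D` anisotropic modulo `p` and the coefficients of `D'` prime to `p`. -/
theorem diagClass_mem_wittFiltration_pred {p : ℕ} (hp : p.Prime)
    {G : Matrix κ κ ℤ} (hG : G.IsSymm) (hdet : IsUnit G.det) {a : ι → ℚˣ}
    (e : (gramForm G).Equivalent (diagForm a)) (ha : diagClass a ∈ wittFiltration p) :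
    diagClass a ∈ wittFiltration (p - 1) := by
  have : Fact p.Prime := ⟨hp⟩
  have hp2 := hp.two_le
  obtain ⟨m, c, hc, hx⟩ := exists_anisotropic_residue ha
  obtain ⟨n, d, D, hdD, hD, hxd⟩ := exists_integral_diagClass_sub_mem hp (by omega) hx
  let b : Fin m → ℚˣ := fun i => primeUnit p * residueRep p (c i)
  have h1 : diagClass (Sum.elim (Sum.elim a fun i => -d i) fun i => -b i) ∈ wittRelations := by
    rw [diagClass_sumElim, diagClass_sumElim]
    have h2 := add_mem (add_mem hxd (diagClass_add_diagClass_neg_mem d))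
      (diagClass_add_diagClass_neg_mem b)
    convert h2 using 1
    simp only [b]
    abel
  have h2 : HasLagrangian (((gramForm G).prod (diagForm fun i => -d i)).prod
      (diagForm fun i => -b i)) := by
    refine (diagClass_mem_wittRelations.1 h1).of_equivalent ?_
    refine (diagForm_sumElim _ _).trans (QuadraticMap.Equivalent.prod ?_ (.refl _))
    exact (diagForm_sumElim _ _).trans (QuadraticMap.Equivalent.prod e.symm (.refl _))
  obtain ⟨W, hW, hWd⟩ := h2
  let Φ : ((κ ⊕ Fin n) ⊕ Fin m → ℚ) ≃ₗ[ℚ] ((κ → ℚ) × (Fin n → ℚ)) × (Fin m → ℚ) :=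
    (LinearEquiv.sumArrowLequivProdArrow (κ ⊕ Fin n) (Fin m) ℚ ℚ).trans
      ((LinearEquiv.sumArrowLequivProdArrow κ (Fin n) ℚ ℚ).prodCongr (.refl ℚ _))
  have hE : (Matrix.fromBlocks G 0 0 (Matrix.diagonal fun i => -D i)).IsSymm :=
    Matrix.IsSymm.fromBlocks hG (by simp) (Matrix.isSymm_diagonal _)
  have hEdet : (((Matrix.fromBlocks G 0 0 (Matrix.diagonal fun i => -D i)).det : ℤ) : ZMod p)
      ≠ 0 := by
    rw [Matrix.det_fromBlocks_zero₂₁, Matrix.det_diagonal, Int.cast_mul]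
    refine mul_ne_zero (hdet.map (Int.castRingHom (ZMod p))).ne_zero ?_
    rw [Int.cast_prod]
    refine Finset.prod_ne_zero_iff.2 fun i _ => ?_
    rw [Int.cast_neg, neg_ne_zero, Ne, ZMod.intCast_zmod_eq_zero_iff_dvd]
    exact hD i
  have hempty := isEmpty_of_anisotropic p _ hE hEdet
    (fun i : Fin m => -((c i : ZMod p).val : ℤ)) (fun y hy => hc y (by
      simpa [Finset.sum_neg_distrib] using hy)) (W.comap Φ.toLinearMap) (fun x hx => by
      rw [← hW _ hx]
      simp [Φ, QuadraticMap.prod_apply, gramForm_apply, Fintype.sum_sum_type, hdD,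
        LinearEquiv.sumArrowLequivProdArrow, Matrix.diagonal_apply, b, primeUnit, residueRep,
        mul_assoc]) (by
      have h3 : finrank ℚ (W.comap Φ.toLinearMap) = finrank ℚ W :=
        (Φ.ofSubmodule' W).finrank_eq
      rw [h3]
      refine le_trans (le_of_eq ?_) hWd
      simp)
  have hm : diagClass b = 0 := by
    rw [diagClass, Finset.univ_eq_empty, Finset.sum_empty]
  have hx' := hx
  change diagClass a - diagClass b ∈ _ at hx'
  rwa [hm, sub_zero] at hx'

/-- A unimodular form whose class has signature zero has a Lagrangian over `ℚ`. -/
theorem hasLagrangian_of_unimodular {G : Matrix κ κ ℤ} (hG : G.IsSymm) (hdet : IsUnit G.det)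
    {a : ι → ℚˣ} (e : (gramForm G).Equivalent (diagForm a))
    (hsign : signatureHom (diagClass a) = 0) : HasLagrangian (gramForm G) := by
  refine HasLagrangian.of_equivalent e.symm (diagClass_mem_wittRelations.1 ?_)
  have hdesc : ∀ k, 1 ≤ k → diagClass a ∈ wittFiltration k → diagClass a ∈ wittFiltration 1 := by
    intro k hk
    induction k, hk using Nat.le_induction with
    | base => exact id
    | succ k hk ih =>
      intro h
      by_cases hp : (k + 1).Prime
      · exact ih (diagClass_mem_wittFiltration_pred hp hG hdet e h)
      · exact ih (wittFiltration_succ_of_not_prime hk hp h)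
  obtain ⟨k, hk, hak⟩ := exists_diagClass_mem_wittFiltration a
  obtain ⟨n, b, hb, hab⟩ := exists_diagClass_sub_mem le_rfl (hdesc k hk hak)
  -- the coefficients `b i` are `± 1`, so `b` is a multiple of `⟨1⟩` in the Witt group
  have h1 : ∀ u ∈ smoothUnits 1, u = 1 ∨ u = -1 := by
    intro u hu
    rw [smoothUnits] at hu
    induction hu using Subgroup.closure_induction with
    | mem u h =>
      obtain ⟨m, hm, hum⟩ := h
      have h2 : m = 0 ∨ m = 1 ∨ m = -1 := by omega
      rcases h2 with rfl | rfl | rfl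
      · simp at hum
      · left; ext; simpa using hum
      · right; ext; simpa using hum
    | one => exact .inl rfl
    | mul x y _ _ hx hy => rcases hx with rfl | rfl <;> rcases hy with rfl | rfl <;> simp
    | inv x _ hx => rcases hx with rfl | rfl <;> simp
  have h2 : ∃ r : ℤ, diagClass b - r • Finsupp.single 1 1 ∈ wittRelations := by
    have h3 : ∀ i, ∃ r : ℤ, Finsupp.single (b i) 1 - r • Finsupp.single 1 1 ∈ wittRelations := by
      intro i
      rcases h1 _ (hb i) with h | h
      · exact ⟨1, by simp [h]⟩
      · refine ⟨-1, ?_⟩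
        rw [h, neg_one_smul, sub_neg_eq_add, add_comm]
        exact single_add_single_neg_mem 1
    choose r hr using h3
    refine ⟨∑ i, r i, ?_⟩
    rw [diagClass, Finset.sum_smul, ← Finset.sum_sub_distrib]
    exact sum_mem fun i _ => hr i
  obtain ⟨r, hr⟩ := h2
  have h3 := add_mem hab hr
  rw [sub_add_sub_cancel] at h3
  have h4 := signatureHom_eq_zero_of_mem h3
  rw [map_sub, hsign, map_zsmul, signatureHom_single] at h4
  have h5 : r = 0 := by simpa using h4
  simpa [h5] using h3

end Unimodular

/-! ### Lattices and their rational forms -/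

section Lattice

open scoped TensorProduct

variable {L : Type*} [AddCommGroup L]

/-- The rational quadratic form `x ↦ B(x, x)` on `ℚ ⊗ L` of an integral bilinear form. -/
noncomputable abbrev ratForm (B : LinearMap.BilinForm ℤ L) : QuadraticForm ℚ (ℚ ⊗[ℤ] L) :=
  (B.baseChange ℚ).toQuadraticMap

theorem exists_smul_eq_one_tmul (x : ℚ ⊗[ℤ] L) :
    ∃ (n : ℤ) (l : L), (n : ℚ) ≠ 0 ∧ (n : ℚ) • x = (1 : ℚ) ⊗ₜ[ℤ] l := by
  have hsmul : ∀ (n : ℤ) (l : L), (n : ℚ) • (1 : ℚ) ⊗ₜ[ℤ] l = (1 : ℚ) ⊗ₜ[ℤ] (n • l) := by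
    intro n l
    rw [TensorProduct.smul_tmul', ← TensorProduct.smul_tmul]
    simp
  induction x using TensorProduct.induction_on with
  | zero => exact ⟨1, 0, by simp, by simp⟩
  | tmul q l =>
    refine ⟨q.den, q.num • l, by simp, ?_⟩
    rw [← hsmul, TensorProduct.smul_tmul', TensorProduct.smul_tmul']
    congr 1
    simp [Rat.den_mul_eq_num]
  | add x y hx hy =>
    obtain ⟨n, l, hn, hl⟩ := hx
    obtain ⟨n', l', hn', hl'⟩ := hy
    refine ⟨n * n', n' • l + n • l', by push_cast; exact mul_ne_zero hn hn', ?_⟩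
    rw [TensorProduct.tmul_add, ← hsmul, ← hsmul, ← hl, ← hl', smul_add, smul_smul, smul_smul]
    push_cast
    rw [mul_comm (n' : ℚ)]

theorem baseChange_one_tmul (B : LinearMap.BilinForm ℤ L) (x y : L) :
    B.baseChange ℚ ((1 : ℚ) ⊗ₜ[ℤ] x) ((1 : ℚ) ⊗ₜ[ℤ] y) = B x y := by
  simp

theorem baseChange_separatingLeft [Module.Free ℤ L] {B : LinearMap.BilinForm ℤ L} (hB : Function.Injective B) :
    (B.baseChange ℚ).SeparatingLeft := by
  intro x hx
  obtain ⟨n, l, hn, hl⟩ := exists_smul_eq_one_tmul x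
  have h1 : l = 0 := by
    apply hB
    rw [map_zero]
    ext y
    have h2 : B.baseChange ℚ ((n : ℚ) • x) (1 ⊗ₜ[ℤ] y) = 0 := by
      rw [map_smul, LinearMap.smul_apply, hx, smul_zero]
    rw [hl] at h2
    simpa using h2
  rw [h1, TensorProduct.tmul_zero] at hl
  exact (smul_eq_zero.1 hl).resolve_left hn

theorem baseChange_isSymm (K : Type*) [Field K] {B : LinearMap.BilinForm ℤ L} (hs : B.IsSymm) :
    (B.baseChange K).IsSymm :=
  LinearMap.BilinForm.isSymm_iff.2
    (LinearMap.BilinForm.IsSymm.baseChange K (LinearMap.BilinForm.isSymm_iff.1 hs))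

theorem gramForm_equivalent_ratForm {κ : Type*} [Fintype κ] [DecidableEq κ]
    (B : LinearMap.BilinForm ℤ L) (b : Basis κ ℤ L) :
    (gramForm (Matrix.of fun i j => B (b i) (b j))).Equivalent (ratForm B) := by
  refine ⟨(b.baseChange ℚ).equivFun.symm, fun x => ?_⟩
  rw [gramForm_apply]
  change ratForm B ((b.baseChange ℚ).equivFun.symm x) = _
  rw [Basis.equivFun_symm_apply, ratForm, LinearMap.BilinMap.toQuadraticMap_apply]
  rw [LinearMap.map_sum₂]
  refine Finset.sum_congr rfl fun i _ => ?_
  rw [map_sum]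
  refine Finset.sum_congr rfl fun j _ => ?_
  rw [map_smul, map_smul, LinearMap.smul_apply, Basis.baseChange_apply, Basis.baseChange_apply,
    baseChange_one_tmul, Matrix.of_apply, smul_eq_mul, smul_eq_mul]
  ring

variable [Module.Finite ℤ L] [Module.Free ℤ L]

/-- A nondegenerate symmetric integral form has an orthogonal basis over `ℚ` which consists of
lattice vectors. -/
theorem exists_orthogonal_family {B : LinearMap.BilinForm ℤ L} (hs : B.IsSymm)
    (hB : Function.Injective B) : ∃ u : Fin (finrank ℤ L) → L,
      (∀ i j, i ≠ j → B (u i) (u j) = 0) ∧ ∀ i, B (u i) (u i) ≠ 0 := by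
  obtain ⟨v, hv⟩ := LinearMap.BilinForm.exists_orthogonal_basis
    (LinearMap.BilinForm.isSymm_iff.1 (baseChange_isSymm ℚ hs))
  have hv0 := LinearMap.IsOrthoᵢ.not_isOrtho_basis_self_of_separatingLeft hv
    (baseChange_separatingLeft hB)
  choose n u hn hu using fun i => exists_smul_eq_one_tmul (v i)
  have hr : finrank ℤ L = finrank ℚ (ℚ ⊗[ℤ] L) := finrank_baseChange.symm
  have key : ∀ i j, (B (u i) (u j) : ℚ) = n i * n j * B.baseChange ℚ (v i) (v j) := by
    intro i j
    rw [← baseChange_one_tmul, ← hu, ← hu]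
    rw [map_smul, map_smul, LinearMap.smul_apply, smul_eq_mul, smul_eq_mul]
    ring
  refine ⟨fun i => u (finCongr hr i), fun i j hij => ?_, fun i h => ?_⟩
  · have h1 := key (finCongr hr i) (finCongr hr j)
    rw [hv ((finCongr hr).injective.ne hij), mul_zero] at h1
    exact_mod_cast h1
  · have h1 := key (finCongr hr i) (finCongr hr i)
    rw [h, Int.cast_zero, eq_comm] at h1
    exact mul_ne_zero (mul_ne_zero (hn _) (hn _)) (hv0 _) h1

theorem baseChange_equivalent_weightedSumSquares (K : Type*) [Field K] [CharZero K]
    {B : LinearMap.BilinForm ℤ L} (hs : B.IsSymm) {u : Fin (finrank ℤ L) → L}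
    (ho : ∀ i j, i ≠ j → B (u i) (u j) = 0) (h0 : ∀ i, B (u i) (u i) ≠ 0) :
    (B.baseChange K).toQuadraticMap.Equivalent
      (QuadraticMap.weightedSumSquares K fun i => (B (u i) (u i) : K)) := by
  have : Invertible (2 : K) := invertibleOfNonzero two_ne_zero
  have hO : (B.baseChange K).IsOrthoᵢ fun i => (1 : K) ⊗ₜ[ℤ] u i := by
    intro i j hij
    change B.baseChange K _ _ = 0
    simp [ho i j hij]
  have hli : LinearIndependent K fun i => (1 : K) ⊗ₜ[ℤ] u i := by
    refine LinearMap.BilinForm.linearIndependent_of_iIsOrtho hO fun i hi => h0 i ?_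
    have h1 : B.baseChange K ((1 : K) ⊗ₜ[ℤ] u i) ((1 : K) ⊗ₜ[ℤ] u i) = 0 := hi
    simpa using h1
  let b : Basis (Fin (finrank ℤ L)) K (K ⊗[ℤ] L) := basisOfLinearIndependentOfCardEqFinrank' _ hli
    (by rw [Fintype.card_fin, finrank_baseChange])
  have hb : ⇑b = fun i => (1 : K) ⊗ₜ[ℤ] u i := by simp [b]
  have hassoc : QuadraticMap.associated (R := K) (B.baseChange K).toQuadraticMap
      = B.baseChange K := QuadraticMap.associated_left_inverse K
        (baseChange_isSymm K hs).eq
  have h1 := QuadraticMap.basisRepr_eq_of_iIsOrtho (B.baseChange K).toQuadraticMap b (by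
    rw [hassoc, hb]
    exact hO)
  have h2 := QuadraticMap.isometryEquivBasisRepr (B.baseChange K).toQuadraticMap b
  rw [h1] at h2
  refine ⟨h2.trans ?_⟩
  refine ⟨LinearEquiv.refl K _, fun x => ?_⟩
  simp [hb]

theorem intSignature_eq {B : LinearMap.BilinForm ℤ L} (hs : B.IsSymm)
    {u : Fin (finrank ℤ L) → L} (ho : ∀ i j, i ≠ j → B (u i) (u j) = 0)
    {a : Fin (finrank ℤ L) → ℚˣ} (ha : ∀ i, (a i : ℚ) = B (u i) (u i)) :
    intSignature B = signatureHom (diagClass a) := by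
  have h0 : ∀ i, B (u i) (u i) ≠ 0 := fun i h => (a i).ne_zero (by rw [ha, h, Int.cast_zero])
  have e := baseChange_equivalent_weightedSumSquares ℝ hs ho h0
  rw [intSignature, QuadraticForm.sigPos_of_equiv_weightedSumSquares e,
    QuadraticForm.sigNeg_of_equiv_weightedSumSquares e, signatureHom_diagClass,
    QuadraticForm.sigPos_weightedSumSquares, QuadraticForm.sigNeg_weightedSumSquares]
  simp [ha]

/-- A unimodular symmetric integral form whose signature is zero has an integral Lagrangian `U`, that
is, `U` is its own orthogonal complement. -/
theorem exists_eq_orthogonal_of_unimodular {B : LinearMap.BilinForm ℤ L} (hs : B.IsSymm)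
    (hB : Function.Bijective B) (hsign : intSignature B = 0) :
    ∃ U : Submodule ℤ L, ∀ x, x ∈ U ↔ ∀ y ∈ U, B x y = 0 := by
  obtain ⟨u, ho, h0⟩ := exists_orthogonal_family hs hB.1
  let a : Fin (finrank ℤ L) → ℚˣ := fun i => Units.mk0 (B (u i) (u i) : ℚ) (by exact_mod_cast h0 i)
  rw [intSignature_eq hs ho (a := a) fun i => rfl] at hsign
  have e := baseChange_equivalent_weightedSumSquares ℚ hs ho h0
  let b := Module.Free.chooseBasis ℤ L
  have hG : (Matrix.of fun i j => B (b i) (b j)).IsSymm := by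
    ext i j
    exact hs.eq _ _
  have hdet : IsUnit (Matrix.of fun i j => B (b i) (b j)).det := by
    have h1 := LinearEquiv.isUnit_det (LinearEquiv.ofBijective B hB) b b.dualBasis
    have h2 : (Matrix.of fun i j => B (b i) (b j))
        = LinearMap.toMatrix b b.dualBasis (LinearEquiv.ofBijective B hB) := by
      ext i j
      rw [LinearMap.toMatrix_apply]
      simp [hs.eq (b i) (b j)]
    rwa [h2]
  have hL : HasLagrangian (ratForm B) := (hasLagrangian_of_unimodular hG hdet
    ((gramForm_equivalent_ratForm B b).trans e) hsign).of_equivalent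
      (gramForm_equivalent_ratForm B b)
  obtain ⟨W, hW, hWd⟩ := hL
  have hnd : (B.baseChange ℚ).Nondegenerate :=
    (LinearMap.IsRefl.nondegenerate_iff_separatingLeft
      (baseChange_isSymm ℚ hs).isRefl).2 (baseChange_separatingLeft hB.1)
  have hWW : ∀ x ∈ W, ∀ y ∈ W, B.baseChange ℚ x y = 0 := by
    intro x hx y hy
    have h1 := QuadraticMap.polar_eq_zero_of_isotropic hW hx hy
    rw [LinearMap.BilinMap.polar_toQuadraticMap, 
      (baseChange_isSymm ℚ hs).eq y x] at h1
    simp at h1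
    linarith
  have hperp : W = (B.baseChange ℚ).orthogonal W := by
    refine Submodule.eq_of_le_of_finrank_le (fun x hx y hy => hWW y hy x hx) ?_
    rw [LinearMap.BilinForm.finrank_orthogonal hnd]
    omega
  refine ⟨(W.restrictScalars ℤ).comap (TensorProduct.mk ℤ ℚ L 1), fun x => ⟨fun hx y hy => ?_,
    fun hx => ?_⟩⟩
  · have h1 := hWW _ hx _ hy
    simpa using h1
  · change (1 : ℚ) ⊗ₜ[ℤ] x ∈ W
    rw [hperp]
    intro w hw
    obtain ⟨n, l, hn, hl⟩ := exists_smul_eq_one_tmul w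
    have h1 := hx l (by
      change (1 : ℚ) ⊗ₜ[ℤ] l ∈ W
      rw [← hl]
      exact W.smul_mem _ hw)
    have h2 : B.baseChange ℚ ((n : ℚ) • w) (1 ⊗ₜ[ℤ] x) = 0 := by
      rw [hl, baseChange_one_tmul, ← hs.eq, h1]
      simp
    rw [map_smul, LinearMap.smul_apply, smul_eq_zero] at h2
    exact h2.resolve_left hn

end Lattice

section LatticeSignature

open scoped TensorProduct

variable {L M K : Type*} [AddCommGroup L] [Module.Finite ℤ L] [Module.Free ℤ L]
  [AddCommGroup M] [Module.Finite ℤ M] [Module.Free ℤ M]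
  [AddCommGroup K] [Module.Free ℤ K]

theorem hasLagrangian_prod_ratForm {S : LinearMap.BilinForm ℤ L} {B : LinearMap.BilinForm ℤ M}
    (f : K →ₗ[ℤ] L) (hf : Function.Injective f) (g : K →ₗ[ℤ] M)
    (hfg : ∀ x, S (f x) (f x) = B (g x) (g x))
    (hd : finrank ℤ L + finrank ℤ M ≤ 2 * finrank ℤ K) :
    HasLagrangian ((ratForm S).prod (ratForm (-B))) := by
  refine .of_injective ((f.baseChange ℚ).prod (g.baseChange ℚ)) ?_ ?_ ?_
  · intro x y hxy
    exact Module.Flat.lTensor_preserves_injective_linearMap (M := ℚ) f hf (congrArg Prod.fst hxy)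
  · intro x
    obtain ⟨n, l, hn, hl⟩ := exists_smul_eq_one_tmul x
    have h1 : ((ratForm S).prod (ratForm (-B)))
        ((f.baseChange ℚ).prod (g.baseChange ℚ) ((n : ℚ) • x)) = 0 := by
      rw [hl]
      simp [QuadraticMap.prod_apply, hfg, -LinearMap.BilinForm.baseChange_tmul, baseChange_one_tmul]
    rw [map_smul, QuadraticMap.map_smul, smul_eq_zero] at h1
    exact h1.resolve_left (mul_ne_zero hn hn)
  · rw [finrank_prod, finrank_baseChange, finrank_baseChange, finrank_baseChange]
    exact hd

/-- If a lattice `K` of at least half the rank embeds in `L ⊕ (-M)` as an isotropic sublattice, by a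
map which is injective in the first component, then `L` and `M` have the same signature. -/
theorem intSignature_eq_of_isotropic {S : LinearMap.BilinForm ℤ L} {B : LinearMap.BilinForm ℤ M}
    (hs : S.IsSymm) (hS : Function.Injective S) (hsB : B.IsSymm) (hB : Function.Injective B)
    (f : K →ₗ[ℤ] L) (hf : Function.Injective f) (g : K →ₗ[ℤ] M)
    (hfg : ∀ x, S (f x) (f x) = B (g x) (g x))
    (hd : finrank ℤ L + finrank ℤ M ≤ 2 * finrank ℤ K) : intSignature S = intSignature B := by
  obtain ⟨u, huo, hu0⟩ := exists_orthogonal_family hs hS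
  obtain ⟨v, hvo, hv0⟩ := exists_orthogonal_family hsB hB
  let a : Fin (finrank ℤ L) → ℚˣ := fun i => Units.mk0 (S (u i) (u i) : ℚ) (by exact_mod_cast hu0 i)
  let b : Fin (finrank ℤ M) → ℚˣ := fun i => Units.mk0 (B (v i) (v i) : ℚ) (by exact_mod_cast hv0 i)
  rw [intSignature_eq hs huo (a := a) fun i => rfl, intSignature_eq hsB hvo (a := b) fun i => rfl]
  have hsB' : (-B).IsSymm := hsB.neg
  have hL := hasLagrangian_prod_ratForm f hf g hfg hd
  have e : (ratForm S).Equivalent (diagForm a) :=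
    baseChange_equivalent_weightedSumSquares ℚ hs huo hu0
  have e' := baseChange_equivalent_weightedSumSquares ℚ hsB' (u := v)
    (fun i j hij => by simp [hvo i j hij]) (fun i => by simpa using hv0 i)
  have e'' : (ratForm (-B)).Equivalent (diagForm fun i => -b i) := by
    have hw : (fun i => ((-b i : ℚˣ) : ℚ)) = fun i => (((-B) (v i) (v i) : ℤ) : ℚ) := by
      funext i
      rw [Units.val_neg, LinearMap.neg_apply, LinearMap.neg_apply, Int.cast_neg]
      rfl
    change (ratForm (-B)).Equivalent
      (QuadraticMap.weightedSumSquares ℚ fun i => ((-b i : ℚˣ) : ℚ))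
    rw [hw]
    exact e'
  have h1 : HasLagrangian (diagForm (Sum.elim a fun i => -b i)) :=
    (hL.of_equivalent (QuadraticMap.Equivalent.prod e e'')).of_equivalent
      (diagForm_sumElim a fun i => -b i).symm
  have h2 := signatureHom_eq_zero_of_mem (diagClass_mem_wittRelations.2 h1)
  have h3 := signatureHom_eq_zero_of_mem (diagClass_add_diagClass_neg_mem b)
  rw [diagClass_sumElim, map_add] at h2
  rw [map_add] at h3
  exact (eq_neg_of_add_eq_zero_left h2).trans (eq_neg_of_add_eq_zero_left h3).symm

end LatticeSignature

/-! ### Direct summands -/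

/-- A subgroup of a finitely generated abelian group with torsion-free quotient is a direct summand. -/
theorem exists_isCompl_of_saturated {P : Type*} [AddCommGroup P] [Module.Finite ℤ P]
    (N : Submodule ℤ P) (h : ∀ (r : ℤ) (x : P), 0 < r → r • x ∈ N → x ∈ N) :
    ∃ C, IsCompl N C := by
  have : Module.IsTorsionFree ℤ (P ⧸ N) := by
    rw [Module.isTorsionFree_iff_smul_eq_zero]
    intro r x hrx
    obtain ⟨x, rfl⟩ := N.mkQ_surjective x
    by_cases hr : r = 0
    · exact .inl hr
    right
    rw [← map_smul, Submodule.mkQ_apply, Submodule.Quotient.mk_eq_zero] at hrx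
    rw [Submodule.mkQ_apply, Submodule.Quotient.mk_eq_zero]
    rcases lt_or_gt_of_ne hr with hr | hr
    · refine h (-r) x (by omega) ?_
      rw [neg_smul]
      exact N.neg_mem hrx
    · exact h r x hr hrx
  obtain ⟨s, hs⟩ := Module.projective_lifting_property N.mkQ LinearMap.id N.mkQ_surjective
  let q : P →ₗ[ℤ] N := (LinearMap.id - s ∘ₗ N.mkQ).codRestrict N (fun x => by
    rw [← Submodule.Quotient.mk_eq_zero, ← Submodule.mkQ_apply]
    have := LinearMap.congr_fun hs (N.mkQ x)
    rw [LinearMap.comp_apply, LinearMap.id_apply] at this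
    rw [LinearMap.sub_apply, map_sub, LinearMap.comp_apply, this, LinearMap.id_apply, sub_self])
  refine ⟨LinearMap.ker q, LinearMap.isCompl_of_proj fun x => ?_⟩
  apply Subtype.ext
  have hx : N.mkQ x = 0 := (Submodule.Quotient.mk_eq_zero N).2 x.2
  change (x : P) - s (N.mkQ x) = x
  rw [hx, map_zero, sub_zero]

/-- An injective homomorphism onto a subgroup with torsion-free quotient has a retraction. -/
theorem exists_retraction_of_saturated {K P : Type*} [AddCommGroup K] [AddCommGroup P]
    [Module.Finite ℤ P] (f : K →ₗ[ℤ] P) (hf : Function.Injective f)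
    (h : ∀ (r : ℤ) (x : P), 0 < r → r • x ∈ LinearMap.range f → x ∈ LinearMap.range f) :
    ∃ g : P →ₗ[ℤ] K, ∀ x, g (f x) = x := by
  obtain ⟨C, hC⟩ := exists_isCompl_of_saturated _ h
  refine ⟨(LinearEquiv.ofInjective f hf).symm.toLinearMap ∘ₗ
    (LinearMap.range f).projectionOnto C hC, fun x => ?_⟩
  rw [LinearMap.comp_apply, Submodule.projectionOnto_apply_of_mem_left hC ⟨x, rfl⟩]
  exact (LinearEquiv.ofInjective f hf).symm_apply_apply x

/-! ### Lagrangians in the kernel of `ρ` -/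

section Obstruction

variable {V : Type u} {A : Type v} {H : Type w} [AddCommGroup V] [AddCommGroup A]
  [Module.Free ℤ A] [AddCommGroup H]
  {S : LinearMap.BilinForm ℤ V} {ρ : V →ₗ[ℤ] A} {j : Dual ℤ V →ₗ[ℤ] H × H}

/-- If `φ ∈ Ker (p₁ j)` and `S⁻¹ φ` lies in `Ker ρ` rationally, then it does so integrally. -/
theorem exists_eq_apply_of_mem_kerP₁ (hS : Function.Injective S) (hex : Function.Exact S j)
    (hc₀ : ∀ φ : Dual ℤ V, (j φ).1 ≠ 0 → (j φ).2 = 0 →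
      ∀ (r : ℤ) (v : V), 0 < r → S v = r • φ → ρ v ≠ 0)
    {φ : Dual ℤ V} (hφ : φ ∈ kerP₁ j) {r : ℤ} {v : V} (hr : 0 < r) (h : S v = r • φ)
    (hv : ρ v = 0) : ∃ w, S w = φ ∧ ρ w = 0 ∧ r • w = v := by
  have hj : j φ = 0 :=
    Prod.ext (by_contra fun h1 => hc₀ φ h1 hφ r v hr h hv) hφ
  obtain ⟨w, rfl⟩ := (hex φ).1 hj
  have hw : r • w = v := hS (by rw [h, map_smul])
  refine ⟨w, rfl, ?_, hw⟩
  rw [← hw, map_smul] at hv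
  exact (smul_eq_zero.1 hv).resolve_left hr.ne'

/-- If `φ ∈ Ker (p₀ j)` and `S⁻¹ φ` lies in `Ker ρ` rationally, then it does so integrally. -/
theorem exists_eq_apply_of_mem_kerP₀ (hS : Function.Injective S) (hex : Function.Exact S j)
    (hc₁ : ∀ φ : Dual ℤ V, (j φ).2 ≠ 0 → (j φ).1 = 0 →
      ∀ (r : ℤ) (v : V), 0 < r → S v = r • φ → ρ v ≠ 0)
    {φ : Dual ℤ V} (hφ : φ ∈ kerP₀ j) {r : ℤ} {v : V} (hr : 0 < r) (h : S v = r • φ)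
    (hv : ρ v = 0) : ∃ w, S w = φ ∧ ρ w = 0 ∧ r • w = v := by
  have hj : j φ = 0 :=
    Prod.ext hφ (by_contra fun h1 => hc₁ φ h1 hφ r v hr h hv)
  obtain ⟨w, rfl⟩ := (hex φ).1 hj
  have hw : r • w = v := hS (by rw [h, map_smul])
  refine ⟨w, rfl, ?_, hw⟩
  rw [← hw, map_smul] at hv
  exact (smul_eq_zero.1 hv).resolve_left hr.ne'

variable [Finite H]

/-- The orthogonal complement of `Ker ρ` is contained in `Ker ρ`, since `S⁻¹` vanishes on the image
of `ρ^*`. -/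
theorem apply_eq_zero_of_orthogonal_ker (hρ : Function.Surjective ρ) (hS : Function.Injective S)
    (hex : Function.Exact S j)
    (hb : ∀ (v₁ v₂ : V) (α₁ α₂ : Dual ℤ A),
      S v₁ = ρ.dualMap α₁ → S v₂ = ρ.dualMap α₂ → S v₁ v₂ = 0)
    {v : V} (hv : ∀ k ∈ LinearMap.ker ρ, S v k = 0) : ρ v = 0 := by
  obtain ⟨α, hα⟩ : ∃ α, ρ.dualMap α = S v := by
    have h1 : S v ∈ (LinearMap.ker ρ).dualAnnihilator :=
      (Submodule.mem_dualAnnihilator _).2 hv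
    rwa [← LinearMap.range_dualMap_eq_dualAnnihilator_ker_of_surjective _ hρ] at h1
  rw [← Module.forall_dual_apply_eq_zero_iff ℤ]
  intro β
  have h1 := apply_scaledInverse hS hex (ρ.dualMap β)
  have h2 := hb _ v ((Nat.card (H × H) : ℤ) • β) α (by rw [h1, map_smul]) hα.symm
  rw [h1, LinearMap.smul_apply, smul_eq_zero] at h2
  exact h2.resolve_left card_prod_pos.ne'

/-- `Ker ρ` is the orthogonal complement of its orthogonal complement. -/
theorem apply_eq_zero_of_orthogonal_orthogonal_ker (hS : Function.Injective S)
    (hex : Function.Exact S j) {v : V}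
    (hv : ∀ r, (∀ k ∈ LinearMap.ker ρ, S r k = 0) → S r v = 0) : ρ v = 0 := by
  rw [← Module.forall_dual_apply_eq_zero_iff ℤ]
  intro β
  have h1 := apply_scaledInverse hS hex (ρ.dualMap β)
  have h2 := hv (scaledInverse S j hS hex (ρ.dualMap β)) fun k hk => by
    rw [h1, LinearMap.smul_apply, LinearMap.dualMap_apply, LinearMap.mem_ker.1 hk, map_zero,
      smul_zero]
  rw [h1, LinearMap.smul_apply, smul_eq_zero] at h2
  exact h2.resolve_left card_prod_pos.ne'

/-- The radical of the form `S` on `Ker ρ`. -/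
def kerRadical (S : LinearMap.BilinForm ℤ V) (ρ : V →ₗ[ℤ] A) : Submodule ℤ (LinearMap.ker ρ) where
  carrier := {r | ∀ k ∈ LinearMap.ker ρ, S r k = 0}
  zero_mem' := by simp
  add_mem' := by
    intro x y hx hy k hk
    simp [hx k hk, hy k hk]
  smul_mem' := by
    intro c x hx k hk
    simp [hx k hk]

variable [Module.Finite ℤ V]

/-- A multiple of `S⁻¹` embeds the image of `ρ^*` in the radical of `Ker ρ`. -/
theorem finrank_le_finrank_kerRadical (hρ : Function.Surjective ρ) (hS : Function.Injective S)
    (hex : Function.Exact S j)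
    (hb : ∀ (v₁ v₂ : V) (α₁ α₂ : Dual ℤ A),
      S v₁ = ρ.dualMap α₁ → S v₂ = ρ.dualMap α₂ → S v₁ v₂ = 0) :
    finrank ℤ A ≤ finrank ℤ (kerRadical S ρ) := by
  have : Module.Finite ℤ A := Module.Finite.of_surjective ρ hρ
  have horth : ∀ α, ∀ k ∈ LinearMap.ker ρ, S (scaledInverse S j hS hex (ρ.dualMap α)) k = 0 := by
    intro α k hk
    rw [apply_scaledInverse hS hex, LinearMap.smul_apply, LinearMap.dualMap_apply,
      LinearMap.mem_ker.1 hk, map_zero, smul_zero]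
  let f : Dual ℤ A →ₗ[ℤ] kerRadical S ρ :=
    ((scaledInverse S j hS hex ∘ₗ ρ.dualMap).codRestrict (LinearMap.ker ρ) fun α =>
      apply_eq_zero_of_orthogonal_ker hρ hS hex hb (horth α)).codRestrict _ horth
  have hf : Function.Injective f := by
    rw [injective_iff_map_eq_zero]
    intro α hα
    have h1 : scaledInverse S j hS hex (ρ.dualMap α) = 0 :=
      congrArg (fun x : kerRadical S ρ => (x : V)) hα
    have h2 := apply_scaledInverse hS hex (ρ.dualMap α)
    rw [h1, map_zero, eq_comm, smul_eq_zero] at h2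
    exact LinearMap.dualMap_injective_of_surjective hρ
      ((h2.resolve_left card_prod_pos.ne').trans (map_zero _).symm)
  rw [((Module.Free.chooseBasis ℤ A).toDualEquiv).finrank_eq]
  exact LinearMap.finrank_le_finrank_of_injective hf

variable [Module.Free ℤ V]

/-- `Ker ρ` contains an isotropic subgroup which is its own orthogonal complement in `V`. -/
theorem exists_lagrangian_le_ker (hρ : Function.Surjective ρ)
    (hS : Function.Injective S) (hex : Function.Exact S j) (hj : Function.Surjective j)
    (hsymm : S.IsSymm) (hsign : intSignature S = 0)
    (hb : ∀ (v₁ v₂ : V) (α₁ α₂ : Dual ℤ A),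
      S v₁ = ρ.dualMap α₁ → S v₂ = ρ.dualMap α₂ → S v₁ v₂ = 0)
    (hc₁ : ∀ φ : Dual ℤ V, (j φ).2 ≠ 0 → (j φ).1 = 0 →
      ∀ (r : ℤ) (v : V), 0 < r → S v = r • φ → ρ v ≠ 0)
    (hc₀ : ∀ φ : Dual ℤ V, (j φ).1 ≠ 0 → (j φ).2 = 0 →
      ∀ (r : ℤ) (v : V), 0 < r → S v = r • φ → ρ v ≠ 0)
    (hint : PairsIntegrally S j) :
    ∃ U : Submodule ℤ (LinearMap.ker ρ), (∀ x ∈ U, ∀ y ∈ U, S x y = 0) ∧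
      ∀ v : V, (∀ y ∈ U, S v y = 0) → ∃ x ∈ U, (x : V) = v := by
  have hn : (0 : ℤ) < Nat.card (H × H) := card_prod_pos
  -- split off the radical of the form on `Ker ρ`
  obtain ⟨M, hM⟩ := exists_isCompl_of_saturated (kerRadical S ρ) (fun r x hr hx k hk => by
    have h1 := hx k hk
    rw [Submodule.coe_smul, map_smul, LinearMap.smul_apply, smul_eq_zero] at h1
    exact h1.resolve_left hr.ne')
  let π : LinearMap.ker ρ →ₗ[ℤ] M := M.projectionOnto _ hM.symm
  have hπM : ∀ m : M, π m = m := fun m => Submodule.projectionOnto_apply_left hM.symm m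
  have hπR : ∀ x, π x = 0 ↔ x ∈ kerRadical S ρ := fun x =>
    Submodule.projectionOnto_apply_eq_zero_iff hM.symm
  let ι : M →ₗ[ℤ] V := (LinearMap.ker ρ).subtype ∘ₗ M.subtype
  let B : LinearMap.BilinForm ℤ M := S.compl₁₂ ι ι
  have hBapp : ∀ x y : M, B x y = S x.1.1 y.1.1 := fun x y => rfl
  have hdiff : ∀ x, x - (π x).1 ∈ kerRadical S ρ := fun x => by
    rw [← hπR, map_sub, hπM, sub_self]
  have hSπl : ∀ x y : LinearMap.ker ρ, S x y = S (π x).1.1 y := fun x y => by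
    have h1 := hdiff x y y.2
    rw [Submodule.coe_sub, map_sub, LinearMap.sub_apply, sub_eq_zero] at h1
    exact h1
  have hSπ : ∀ x y : LinearMap.ker ρ, S x y = B (π x) (π y) := fun x y => by
    rw [hSπl x y, ← hsymm.eq, hSπl y, ← hsymm.eq]
    rfl
  have hBs : B.IsSymm := ⟨fun x y => hsymm.eq _ _⟩
  have hBinj : Function.Injective B := by
    rw [injective_iff_map_eq_zero]
    intro m hm
    have h1 : m.1 ∈ kerRadical S ρ := fun k hk => by
      have h2 := hSπ m.1 ⟨k, hk⟩
      rw [hπM, hm] at h2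
      exact h2
    rw [← hπR, hπM] at h1
    exact h1
  have hBsurj : Function.Surjective B := by
    intro χ
    have hSmem : ∀ v, S v ∈ kerP₀ j := fun v => by
      simp [show j (S v) = 0 from (hex _).2 ⟨v, rfl⟩]
    let g : LinearMap.ker ρ →ₗ[ℤ] kerP₀ j :=
      (S ∘ₗ (LinearMap.ker ρ).subtype).codRestrict (kerP₀ j) fun v => hSmem v
    obtain ⟨s, hs⟩ := exists_retraction_of_saturated g
      (fun x y hxy => Subtype.ext (hS (congrArg Subtype.val hxy))) (by
        rintro r ψ hr ⟨k, hk⟩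
        obtain ⟨w, hw, hρw, -⟩ := exists_eq_apply_of_mem_kerP₀ hS hex hc₁ ψ.2 hr
          (congrArg Subtype.val hk) k.2
        exact ⟨⟨w, hρw⟩, Subtype.ext hw⟩)
    obtain ⟨φ, hφ⟩ := (inducedPairing_bijective hsymm hS hex hj hint).2 (χ ∘ₗ π ∘ₗ s)
    have hφk : ∀ k : LinearMap.ker ρ, inducedPairing hS hex hint φ (g k) = χ (π k) := fun k => by
      rw [hφ, LinearMap.comp_apply, LinearMap.comp_apply, hs]
    -- `S⁻¹ φ` is rationally in `Ker ρ`, as it is orthogonal to the radical of `Ker ρ`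
    obtain ⟨w, hw, hρw, -⟩ := exists_eq_apply_of_mem_kerP₁ hS hex hc₀ φ.2 hn
      (apply_scaledInverse hS hex φ.1)
      (apply_eq_zero_of_orthogonal_orthogonal_ker hS hex fun r hr => by
        have hρr := apply_eq_zero_of_orthogonal_ker hρ hS hex hb hr
        have h1 := inducedPairing_spec hS hex hint φ (g ⟨r, hρr⟩) (apply_scaledInverse hS hex φ.1)
        rw [hφk, (hπR ⟨r, hρr⟩).2 hr, map_zero, mul_zero] at h1
        exact h1.symm)
    refine ⟨π ⟨w, hρw⟩, ?_⟩
    ext m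
    have h1 := inducedPairing_apply_S hS hex hint φ (g m.1) hw.symm
    rw [hφk, hπM] at h1
    have h2 := hSπ ⟨w, hρw⟩ m.1
    rw [hπM] at h2
    rw [← h2, h1]
    exact hsymm.eq _ _
  have hBsign : intSignature B = 0 := by
    rw [← hsign]
    symm
    have : Module.Finite ℤ A := Module.Finite.of_surjective ρ hρ
    refine intSignature_eq_of_isotropic hsymm hS hBs hBinj (LinearMap.ker ρ).subtype
      (LinearMap.ker ρ).injective_subtype π (fun x => hSπ x x) ?_
    have h1 := finrank_le_finrank_kerRadical hρ hS hex hb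
    have h2 := (LinearMap.ker ρ).finrank_quotient_add_finrank
    rw [(ρ.quotKerEquivOfSurjective hρ).finrank_eq] at h2
    have h3 := (Submodule.prodEquivOfIsCompl _ _ hM).finrank_eq
    rw [finrank_prod] at h3
    omega
  obtain ⟨U, hU⟩ := exists_eq_orthogonal_of_unimodular hBs ⟨hBinj, hBsurj⟩ hBsign
  refine ⟨U.comap π, fun x hx y hy => ?_, fun v hv => ?_⟩
  · rw [hSπ]
    exact (hU _).1 hx _ hy
  · have hρv : ρ v = 0 := apply_eq_zero_of_orthogonal_orthogonal_ker hS hex fun r hr => by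
      have hρr := apply_eq_zero_of_orthogonal_ker hρ hS hex hb hr
      have h1 := hv ⟨r, hρr⟩ (by
        rw [Submodule.mem_comap, (hπR ⟨r, hρr⟩).2 hr]
        exact zero_mem _)
      rw [← h1]
      exact hsymm.eq _ _
    refine ⟨⟨v, hρv⟩, (hU _).2 fun y hy => ?_, rfl⟩
    have h1 := hv y.1 (by rwa [Submodule.mem_comap, hπM])
    have h2 := hSπ ⟨v, hρv⟩ y.1
    rw [hπM] at h2
    rw [← h2]
    exact h1

/-- An isotropic subgroup of `Ker ρ` which is its own orthogonal complement in `V` exhibits the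
obstruction as elementary. -/
theorem isElementarySubmodule_of_lagrangian (hsymm : S.IsSymm)
    (hS : Function.Injective S) (hex : Function.Exact S j) (hj : Function.Surjective j)
    (hc₁ : ∀ φ : Dual ℤ V, (j φ).2 ≠ 0 → (j φ).1 = 0 →
      ∀ (r : ℤ) (v : V), 0 < r → S v = r • φ → ρ v ≠ 0)
    (hc₀ : ∀ φ : Dual ℤ V, (j φ).1 ≠ 0 → (j φ).2 = 0 →
      ∀ (r : ℤ) (v : V), 0 < r → S v = r • φ → ρ v ≠ 0)
    (hint : PairsIntegrally S j) (heven : ∀ v ∈ LinearMap.ker ρ, Even (S v v))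
    (U : Submodule ℤ (LinearMap.ker ρ)) (hU : ∀ x ∈ U, ∀ y ∈ U, S x y = 0)
    (hU' : ∀ v : V, (∀ y ∈ U, S v y = 0) → ∃ x ∈ U, (x : V) = v) :
    (obstructionTriple S ρ j hsymm hS hex hj hint heven).IsElementarySubmodule U := by
  set T := obstructionTriple S ρ j hsymm hS hex hj hint heven
  have hlam : ∀ (φ : kerP₁ j) (y : LinearMap.ker ρ) (v : V), φ.1 = S v →
      T.lam φ (T.g y) = S y v := fun φ y v h =>
    inducedPairing_apply_S hS hex hint φ (T.g y) h
  have hsat : ∀ (r : ℤ) (w : V) (x : LinearMap.ker ρ), 0 < r → x ∈ U → r • w = x →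
      ∃ y ∈ U, (y : V) = w := by
    intro r w x hr hx hw
    refine hU' w fun y hy => ?_
    have h1 := hU x hx y hy
    rw [← hw, map_smul, LinearMap.smul_apply, smul_eq_zero] at h1
    exact h1.resolve_left hr.ne'
  have hmap₀ : ∀ (r : ℤ) (φ : kerP₁ j) (x : LinearMap.ker ρ), 0 < r → x ∈ U →
      S x = r • φ.1 → φ ∈ U.map T.f := by
    intro r φ x hr hx h
    obtain ⟨w, hw, -, hrw⟩ := exists_eq_apply_of_mem_kerP₁ hS hex hc₀ φ.2 hr h x.2
    obtain ⟨y, hy, rfl⟩ := hsat r w x hr hx hrw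
    exact ⟨y, hy, Subtype.ext hw⟩
  refine
    { free := inferInstanceAs (Module.Free ℤ U)
      finite := inferInstanceAs (Module.Finite ℤ U)
      isotropic := fun x hx y hy => (hlam (T.f x) y x.1 rfl).trans (hU y hy x hx)
      mu_eq_zero := fun x hx => ?_
      injOn_f := fun x _ y _ hxy => Subtype.ext (hS (congrArg Subtype.val hxy))
      summand₀ := exists_isCompl_of_saturated (P := kerP₁ j) _ ?_
      injOn_g := fun x _ y _ hxy => Subtype.ext (hS (congrArg Subtype.val hxy))
      summand₁ := exists_isCompl_of_saturated (P := kerP₀ j) _ ?_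
      lam_iso := ?_ }
  · change S x.1 x.1 / 2 = 0
    rw [hU x hx x hx]
    rfl
  · rintro r φ hr ⟨x, hx, hxφ⟩
    exact hmap₀ r φ x hr hx (congrArg Subtype.val hxφ)
  · rintro r φ hr ⟨x, hx, hxφ⟩
    obtain ⟨w, hw, -, hrw⟩ := exists_eq_apply_of_mem_kerP₀ hS hex hc₁ φ.2 hr
      (congrArg Subtype.val hxφ) x.2
    obtain ⟨y, hy, rfl⟩ := hsat r w x hr hx hrw
    exact ⟨y, hy, Subtype.ext hw⟩
  · have hvan : ∀ φ : U.map T.f, U.map T.g ≤ LinearMap.ker (T.lam φ) := by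
      rintro ⟨_, x, hx, rfl⟩ _ ⟨y, hy, rfl⟩
      exact (hlam (T.f x) y x.1 rfl).trans (hU y hy x hx)
    let E : U.map T.f →ₗ[ℤ] Dual ℤ (T.V₁ ⧸ U.map T.g) :=
      { toFun := fun φ => (U.map T.g).liftQ (T.lam φ) (hvan φ)
        map_add' := fun φ φ' => by
          ext y
          simp
        map_smul' := fun c φ => by
          ext y
          simp }
    refine ⟨LinearEquiv.ofBijective E ⟨?_, fun χ => ?_⟩, fun φ y => rfl⟩
    · rw [injective_iff_map_eq_zero]
      intro φ hφ
      apply Subtype.ext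
      apply T.lam_bijective.1
      rw [Submodule.coe_zero, map_zero]
      ext y
      exact LinearMap.congr_fun hφ (Submodule.Quotient.mk y)
    · obtain ⟨φ, hφ⟩ := T.lam_bijective.2 (χ ∘ₗ (U.map T.g).mkQ)
      have hφ' : ∀ y ∈ U, T.lam φ (T.g y) = 0 := fun y hy => by
        rw [hφ]
        exact (congrArg χ ((Submodule.Quotient.mk_eq_zero _).2 ⟨y, hy, rfl⟩)).trans (map_zero χ)
      -- `S⁻¹ φ` is orthogonal to `U`, so it lies in `U`
      obtain ⟨x, hx, hxφ⟩ := hU' (scaledInverse S j hS hex φ.1) fun y hy => by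
        have h1 := inducedPairing_spec hS hex hint φ (T.g y) (apply_scaledInverse hS hex φ.1)
        have h2 : inducedPairing hS hex hint φ (T.g y) = 0 := hφ' y hy
        rw [h2, mul_zero] at h1
        rw [← hsymm.eq]
        exact h1.symm
      refine ⟨⟨φ, hmap₀ _ φ x card_prod_pos hx (by rw [hxφ, apply_scaledInverse hS hex])⟩, ?_⟩
      ext y
      exact LinearMap.congr_fun hφ y

end Obstruction

theorem proposition13 {V : Type u} {A : Type v} {H : Type w}
    [AddCommGroup V] [Module.Finite ℤ V] [Module.Free ℤ V]
    [AddCommGroup A] [Module.Free ℤ A]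
    [AddCommGroup H] [Finite H]
    (S : LinearMap.BilinForm ℤ V) (ρ : V →ₗ[ℤ] A) (j : Dual ℤ V →ₗ[ℤ] H × H)
    (hρ : Function.Surjective ρ)
    -- `0 → V → V^* → H ⊕ H → 0` is exact
    (hS : Function.Injective S) (hex : Function.Exact S j) (hj : Function.Surjective j)
    -- `S` is symmetric with signature `0`
    (hsymm : S.IsSymm) (hsign : intSignature S = 0)
    -- `S⁻¹` vanishes on the image of `ρ^*`
    (hb : ∀ (v₁ v₂ : V) (α₁ α₂ : Dual ℤ A),
      S v₁ = ρ.dualMap α₁ → S v₂ = ρ.dualMap α₂ → S v₁ v₂ = 0)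
    -- non-degeneracy, and the same with the two summands interchanged
    (hc₁ : ∀ φ : Dual ℤ V, (j φ).2 ≠ 0 → (j φ).1 = 0 →
      ∀ (r : ℤ) (v : V), 0 < r → S v = r • φ → ρ v ≠ 0)
    (hc₀ : ∀ φ : Dual ℤ V, (j φ).1 ≠ 0 → (j φ).2 = 0 →
      ∀ (r : ℤ) (v : V), 0 < r → S v = r • φ → ρ v ≠ 0)
    -- `S` induces an integral pairing `λ` and `λ` has a quadratic refinement on `Ker ρ`
    (hint : PairsIntegrally S j) (heven : ∀ v ∈ LinearMap.ker ρ, Even (S v v)) :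
    (obstructionTriple S ρ j hsymm hS hex hj hint heven).toLZero.IsElementary := by
  obtain ⟨U, hU, hU'⟩ :=
    exists_lagrangian_le_ker hρ hS hex hj hsymm hsign hb hc₁ hc₀ hint
  exact ⟨_, rfl, U, isElementarySubmodule_of_lagrangian hsymm hS hex hj hc₁ hc₀ hint heven U hU hU'⟩
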